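/- Let $F=\mathbb F_q$ be a finite field with $q$ elements, of odd characteristic, in which $-1$ is a square, and let $0\le k\le n$ be integers. Over the algebraic closure $\overline{\mathbb F}_q$ let $\mathrm{SO}_n=\{g\in \mathrm{SL}_n : g g^{T}=1\}$, let $\mathrm S(\mathrm O_k\times \mathrm O_{n-k})\subset \mathrm{SO}_n$ be the subgroup of block diagonal matrices with diagonal blocks of sizes $k$ and $n-k$, and let $\mathrm{Gr}(k,n)_{\mathbb F_q}$ denote the set of $\mathbb F_q$-points of the variety $\mathrm{SO}_n/\mathrm S(\mathrm O_k\times \mathrm O_{n-k})$, i.e. the set of cosets in $\mathrm{SO}_n(\overline{\mathbb F}_q)/\mathrm S(\mathrm O_k\times \mathrm O_{n-k})(\overline{\mathbb F}_q)$ that are fixed by the Frobenius map $x\mapsto x^q$ (applied to the matrix entries). Let $s_i=(i\;\,i{+}1)$, $1\le i\le n-1$, be the simple reflections of the symmetric group $S_n$, let $\ell$ be the length function of $S_n$ (the number of inversions), let $P_k=\langle s_i : 1\le i\le n-1,\ i\ne k\rangle$, and let $S_n^{(k)}=\{t\in S_n : \ell(ts)\ge \ell(t)\text{ for all } s\in P_k\}$.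 For $w\in S_n^{(k)}$ let $Y_w$ be the Young diagram with rows numbered $1,\dots,k$ from the bottom, whose $j$-th row has $w(j)-j$ boxes, labelled from left to right by $s_j,s_{j+1},\dots,s_{w(j)-1}$. Let $\eta(w)$ be the number of boxes of $Y_w$ whose label $s_i$ satisfies $i\equiv k \pmod 2$. Define the polynomial $$p(x)=(-1)^{k(n-k)}\sum_{w\in S_n^{(k)}}(-1)^{\ell(w)}x^{\eta(w)}\in\mathbb Z[x].$$ Then $\deg p\le k(n-k)$, the set $\mathrm{Gr}(k,n)_{\mathbb F_q}$ is finite, and $$|\mathrm{Gr}(k,n)_{\mathbb F_q}| = q^{\,r}\,p(q),\qquad r=k(n-k)-\deg p .$$ -/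

import Mathlib

open Polynomial

noncomputable section

namespace RealGrassmannian

/-! ### Permutations, minimal coset representatives and Young diagrams

Positions and values are `Fin n`, that is, `0, …, n - 1`; the number `j` in `{1, …, n}` corresponds
to `j - 1` in `Fin n`. -/

/-- The Coxeter length `ℓ(w)` of a permutation: its number of inversions. -/
def length {n : ℕ} (w : Equiv.Perm (Fin n)) : ℕ :=
  (Finset.univ.filter fun x : Fin n × Fin n => x.1 < x.2 ∧ w x.2 < w x.1).card

/-- The parabolic subgroup `P_k` of `S_n`, generated by the simple reflections
`s_b = (b, b + 1)`, `1 ≤ b ≤ n - 1`, with `b ≠ k`.  (In `Fin n`, `s_b` exchanges `b - 1` and `b`.) -/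
def parabolic (k n : ℕ) : Subgroup (Equiv.Perm (Fin n)) :=
  Subgroup.closure
    {s | ∃ a b : Fin n, (a : ℕ) + 1 = (b : ℕ) ∧ (b : ℕ) ≠ k ∧ s = Equiv.swap a b}

open Classical in
/-- The set `S_n^{(k)}` of minimal length representatives of the cosets `t P_k`. -/
def minimalReps (k n : ℕ) : Finset (Equiv.Perm (Fin n)) :=
  Finset.univ.filter fun t => ∀ s ∈ parabolic k n, length t ≤ length (t * s)

/-- The Young diagram `Y_w`.  Its row `j` (`1 ≤ j ≤ k`, counted from the bottom) consists of
`w(j) - j` boxes, labelled from left to right by the simple reflections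
`s_j, s_{j+1}, …, s_{w(j)-1}`.  The pair `⟨i, l⟩` stands for the box labelled `s_l` in row
`j = i + 1`. -/
def youngDiagram (k : ℕ) {n : ℕ} (w : Equiv.Perm (Fin n)) : Finset (Σ _ : Fin n, ℕ) :=
  (Finset.univ.filter fun i : Fin n => (i : ℕ) < k).sigma
    fun i => Finset.Ico ((i : ℕ) + 1) ((w i : ℕ) + 1)

/-- `η(w)`: the number of letters `q` in `Y_w`, when the boxes labelled `s_{k ± 2j}` are filled
with `q` and the boxes labelled `s_{k ± (2j+1)}` are filled with `1`. -/
def eta (k : ℕ) {n : ℕ} (w : Equiv.Perm (Fin n)) : ℕ :=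
  ((youngDiagram k w).filter fun x => x.2 % 2 = k % 2).card

/-- The polynomial `p = (-1)^{k(n-k)} ∑_{w ∈ S_n^{(k)}} (-1)^{ℓ(w)} q^{η(w)}` in the variable `q`. -/
def cellPolynomial (k n : ℕ) : ℤ[X] :=
  (-1) ^ (k * (n - k)) * ∑ w ∈ minimalReps k n, (-1) ^ length w * X ^ eta k w

/-! ### The variety `SO_n / S(O_k × O_{n-k})` -/

/-- The special orthogonal group of the form `x_1² + ⋯ + x_n²` over `E`. -/
abbrev SO (n : ℕ) (E : Type*) [Field E] : Type _ :=
  Matrix.specialOrthogonalGroup (Fin n) E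

theorem SO_mul_transpose {n : ℕ} {E : Type*} [Field E] (g : SO n E) :
    g.1 * g.1.transpose = 1 :=
  (Matrix.mem_orthogonalGroup_iff _ _).1 (Matrix.mem_specialOrthogonalGroup_iff.1 g.2).1

theorem SO_coe_inv {n : ℕ} {E : Type*} [Field E] (g : SO n E) :
    (g⁻¹).1 = g.1.transpose := rfl

/-- The subgroup `S(O_k × O_{n-k})` of `SO_n`: the block diagonal matrices with a block of size `k`
followed by a block of size `n - k`. -/
def blockSubgroup (k n : ℕ) (E : Type*) [Field E] : Subgroup (SO n E) where
  carrier := {g | ∀ i j : Fin n, ¬ ((i : ℕ) < k ↔ (j : ℕ) < k) → g.1 i j = 0}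
  one_mem' := by
    intro i j h
    have hij : i ≠ j := by
      rintro rfl
      exact h Iff.rfl
    exact Matrix.one_apply_ne hij
  mul_mem' := by
    intro a b ha hb i j h
    change (a.1 * b.1) i j = 0
    rw [Matrix.mul_apply]
    refine Finset.sum_eq_zero fun l _ => ?_
    by_cases hl : (i : ℕ) < k ↔ (l : ℕ) < k
    · rw [hb l j (fun h' => h (hl.trans h')), mul_zero]
    · rw [ha i l hl, zero_mul]
  inv_mem' := by
    intro a ha i j h
    exact ha j i (fun h' => h h'.symm)

/-- The points over `E` of the homogeneous variety `SO_n / S(O_k × O_{n-k})`, for `E` an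
algebraically closed field. -/
abbrev Points (k n : ℕ) (E : Type*) [Field E] : Type _ :=
  SO n E ⧸ blockSubgroup k n E

/-- A ring homomorphism, applied entrywise to special orthogonal matrices. -/
def SOmap (n : ℕ) {E : Type*} [Field E] (φ : E →+* E) : SO n E →* SO n E where
  toFun g := ⟨g.1.map φ, by
    rw [Matrix.mem_specialOrthogonalGroup_iff, Matrix.mem_orthogonalGroup_iff]
    constructor
    · rw [← Matrix.transpose_map, ← Matrix.map_mul, SO_mul_transpose,
        Matrix.map_one _ (map_zero φ) (map_one φ)]
    · have h := (Matrix.mem_specialOrthogonalGroup_iff.1 g.2).2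
      have h2 := RingHom.map_det φ g.1
      rw [h, map_one] at h2
      exact h2.symm⟩
  map_one' := Subtype.ext (Matrix.map_one _ (map_zero φ) (map_one φ))
  map_mul' a b := Subtype.ext Matrix.map_mul

theorem SOmap_mem_blockSubgroup {k n : ℕ} {E : Type*} [Field E] (φ : E →+* E) {g : SO n E}
    (hg : g ∈ blockSubgroup k n E) : SOmap n φ g ∈ blockSubgroup k n E := by
  intro i j h
  change φ (g.1 i j) = 0
  rw [hg i j h, map_zero]

/-- The map `g S(O_k × O_{n-k}) ↦ φ(g) S(O_k × O_{n-k})` induced by a ring homomorphism `φ`. -/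
def pointsMap (k n : ℕ) {E : Type*} [Field E] (φ : E →+* E) : Points k n E → Points k n E :=
  Quotient.map' (SOmap n φ) (by
    intro a b h
    rw [QuotientGroup.leftRel_apply] at h ⊢
    rw [← map_inv, ← map_mul]
    exact SOmap_mem_blockSubgroup φ h)

/-- The `F`-points of `SO_n / S(O_k × O_{n-k})`, for a finite field `F` with `q` elements: the
points over an algebraic closure of `F` that are fixed by the Frobenius map `x ↦ x^q`. -/
def rationalPoints (k n : ℕ) (F : Type*) [Field F] [Fintype F] :
    Set (Points k n (AlgebraicClosure F)) :=
  {x | pointsMap k n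
    (FiniteField.frobeniusAlgHom F (AlgebraicClosure F) :
      AlgebraicClosure F →+* AlgebraicClosure F) x = x}

end RealGrassmannian

end

noncomputable section

namespace RealGrassmannian

/-! ### Minimal coset representatives -/

/-! Both sides are computed in closed form and compared by the parities of `k` and `n - k`.
Geometric side. The coset of `g` is sent to `g D gᵀ`, where `D` is the projection onto the first `k`
coordinates. The block subgroup is the centraliser of `D`, so this map is injective. Over an
algebraically closed field of characteristic not 2 its image is the set of all symmetric idempotents
of rank `k` (`range_toProj`). The map commutes with Frobenius, so the rational points correspond to
symmetric idempotents over `F`, that is, to nondegenerate `k`-dimensional subspaces of `F^n`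
(`toProj_image_rationalPoints`). For `k ≥ 1` such a subspace has an orthogonal basis with norms `(1,
…, 1, c)`, where `c` is 1 or a fixed nonsquare; the discriminant tells the two classes apart
(`idemCount_succ`). Each class is counted as the number of frames in `F^n` divided by the number of
isometries of the model form (`projCount_mul`). Both numbers are found by splitting off vectors of
norm 1, on which isometries act transitively (`card_frames_succ`), and by counting such vectors
(`normCount_lastWeight`); this count is simple because `x² + y²` is hyperbolic when `-1` is a
square. Adding the two classes gives `idemCount_formulas`. Combinatorial side. A minimal
representative `w` amounts to the set of its first `k` values, and `ℓ(w)` and `η(w)` are, up to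
constants, sums over that set. So `p` is, up to sign and a power of `X`, an elementary symmetric
function of signed powers of `X` (`cellPolynomial_mul`). Apart from at most two unpaired weights,
these weights occur in pairs `±X^m`, so the generating function is essentially a product of factors
`1 - X^(2m) t²`, and the `q`-binomial theorem yields a Gaussian binomial in `X²`, with an extra
factor when `k` and `n - k` are both odd. -/

/-- Permutations that increase on the first `k` positions and on the remaining ones. -/
def IsBlockIncreasing (k : ℕ) {n : ℕ} (t : Equiv.Perm (Fin n)) : Prop :=
  ∀ a b : Fin n, a < b → ((b : ℕ) < k ∨ k ≤ (a : ℕ)) → t a < t b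

/-- The number of inversions of `t` between the first `k` positions and the remaining ones. -/
def crossInversions (k : ℕ) {n : ℕ} (t : Equiv.Perm (Fin n)) : ℕ :=
  (Finset.univ.filter fun x : Fin n × Fin n =>
    ((x.1 : ℕ) < k ∧ k ≤ (x.2 : ℕ)) ∧ t x.2 < t x.1).card

/-- An adjacent transposition changes the relative order of the positions `a`, `b` only, so it
carries the inversions of the new permutation injectively to inversions of `t` other than `(a, b)`.
-/
theorem length_mul_swap_lt {n : ℕ} (t : Equiv.Perm (Fin n)) {a b : Fin n}
    (hab : (a : ℕ) + 1 = b) (h : t b < t a) : length (t * Equiv.swap a b) < length t := by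
  have hlt : a < b := by rw [Fin.lt_def]; omega
  have hmem : (a, b) ∈ (Finset.univ.filter fun x : Fin n × Fin n => x.1 < x.2 ∧ t x.2 < t x.1) := by
    simp [hlt, h]
  unfold length
  refine lt_of_le_of_lt ?_ (Finset.card_erase_lt_of_mem hmem)
  refine Finset.card_le_card_of_injOn
    (fun x => (Equiv.swap a b x.1, Equiv.swap a b x.2)) ?_ ?_
  · rintro ⟨x, y⟩ hxy
    rw [Finset.mem_coe, Finset.mem_filter] at hxy
    obtain ⟨-, h1, h2⟩ := hxy
    simp only [Equiv.Perm.mul_apply] at h1 h2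
    rw [Finset.mem_coe, Finset.mem_erase, Finset.mem_filter, ne_eq, Prod.mk.injEq]
    refine ⟨?_, Finset.mem_univ _, ?_, h2⟩
    rotate_left
    · dsimp only
      rw [Equiv.swap_apply_def, Equiv.swap_apply_def] at h2
      rw [Equiv.swap_apply_def, Equiv.swap_apply_def]
      simp only [Fin.ext_iff, Fin.lt_def] at *
      split_ifs at * <;> omega
    · rintro ⟨hx, hy⟩
      rw [Equiv.swap_apply_eq_iff] at hx hy
      simp only [Equiv.swap_apply_left, Equiv.swap_apply_right] at hx hy
      subst hx hy
      exact lt_asymm h1 hlt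
  · rintro ⟨x, y⟩ _ ⟨x', y'⟩ _ hxy
    simpa using hxy

theorem lt_iff_of_mem_parabolic {k n : ℕ} {s : Equiv.Perm (Fin n)} (hs : s ∈ parabolic k n) :
    ∀ i : Fin n, ((s i : Fin n) : ℕ) < k ↔ (i : ℕ) < k := by
  unfold parabolic at hs
  induction hs using Subgroup.closure_induction with
  | mem x hx =>
    obtain ⟨a, b, hab, hb, rfl⟩ := hx
    intro i
    rw [Equiv.swap_apply_def]
    split_ifs with h1 h2
    · subst h1; omega
    · subst h2; omega
    · rfl
  | one => intro i; rfl
  | mul x y _ _ hx hy => intro i; rw [Equiv.Perm.mul_apply, hx, hy]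
  | inv x _ hx => intro i; rw [← hx (x⁻¹ i)]; simp

theorem crossInversions_le_length (k : ℕ) {n : ℕ} (t : Equiv.Perm (Fin n)) :
    crossInversions k t ≤ length t := by
  unfold crossInversions length
  refine Finset.card_le_card fun x hx => ?_
  simp only [Finset.mem_filter, Finset.mem_univ, true_and] at hx ⊢
  exact ⟨Fin.lt_def.2 (by omega), hx.2⟩

theorem IsBlockIncreasing.length_eq {k n : ℕ} {t : Equiv.Perm (Fin n)}
    (ht : IsBlockIncreasing k t) : length t = crossInversions k t := by
  refine le_antisymm (Finset.card_le_card fun x hx => ?_) (crossInversions_le_length k t)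
  simp only [Finset.mem_filter, Finset.mem_univ, true_and] at hx ⊢
  refine ⟨?_, hx.2⟩
  by_contra hcon
  exact lt_asymm hx.2 (ht x.1 x.2 hx.1 (by omega))

/-- Elements of `P_k` preserve both blocks of positions, so the pairs can be reindexed by `s × s`.
Cross inversions are thus an invariant of the coset and bound every length in it from below. -/
theorem crossInversions_mul {k n : ℕ} (t : Equiv.Perm (Fin n)) {s : Equiv.Perm (Fin n)}
    (hs : s ∈ parabolic k n) : crossInversions k (t * s) = crossInversions k t := by
  have h := lt_iff_of_mem_parabolic hs
  unfold crossInversions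
  refine Finset.card_equiv (Equiv.prodCongr s s) fun x => ?_
  have h' : ∀ i, k ≤ ((s i : Fin n) : ℕ) ↔ k ≤ (i : ℕ) := fun i => by
    rw [← not_lt, ← not_lt, h]
  rw [Finset.mem_filter, Finset.mem_filter]
  simp [h, h']

/-- A descent inside a block could be removed by a generator of `P_k`, so a minimal `t` increases
along adjacent positions of each block. Conversely a block-increasing `t` has only cross inversions,
which attains the lower bound on its coset. -/
theorem mem_minimalReps_iff {k n : ℕ} {t : Equiv.Perm (Fin n)} :
    t ∈ minimalReps k n ↔ IsBlockIncreasing k t := by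
  simp only [minimalReps, Finset.mem_filter, Finset.mem_univ, true_and]
  constructor
  · intro h
    have hadj : ∀ a b : Fin n, (a : ℕ) + 1 = b → (b : ℕ) ≠ k → t a < t b := by
      intro a b hab hb
      by_contra hcon
      have hne : t a ≠ t b := fun he => by
        have := congrArg Fin.val (t.injective he); omega
      have := length_mul_swap_lt t hab (lt_of_le_of_ne (not_lt.1 hcon) hne.symm)
      exact absurd (h _ (Subgroup.subset_closure ⟨a, b, hab, hb, rfl⟩)) (not_le.2 this)
    have key : ∀ d : ℕ, ∀ a b : Fin n, (a : ℕ) + (d + 1) = b →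
        ((b : ℕ) < k ∨ k ≤ (a : ℕ)) → t a < t b := by
      intro d
      induction d with
      | zero => intro a b hab hk; exact hadj a b (by omega) (by omega)
      | succ d ih =>
        intro a b hab hk
        have hlt : (a : ℕ) + (d + 1) < n := by have := b.2; omega
        exact (ih a ⟨a + (d + 1), hlt⟩ rfl (by simp only; omega)).trans
          (hadj _ b (by simp only; omega) (by omega))
    intro a b hab hk
    rw [Fin.lt_def] at hab
    exact key (b - a - 1) a b (by omega) hk
  · intro h s hs
    rw [h.length_eq, ← crossInversions_mul t hs]
    exact crossInversions_le_length k _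

/-- The positions `< k`. -/
def firstBlock (k n : ℕ) : Finset (Fin n) := Finset.univ.filter fun i : Fin n => (i : ℕ) < k

@[simp] theorem mem_firstBlock {k n : ℕ} {i : Fin n} : i ∈ firstBlock k n ↔ (i : ℕ) < k := by
  simp [firstBlock]

/-- There are `t i` values below `t i`; those taken in the first block are exactly the ones at the
`i` earlier positions. -/
theorem IsBlockIncreasing.card_add {k n : ℕ} {t : Equiv.Perm (Fin n)}
    (ht : IsBlockIncreasing k t) {i : Fin n} (hi : (i : ℕ) < k) :
    (Finset.univ.filter fun j : Fin n => k ≤ (j : ℕ) ∧ t j < t i).card + i = t i := by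
  have h1 : (Finset.univ.filter fun j : Fin n => (j : ℕ) < k ∧ t j < t i) = Finset.Iio i := by
    ext j
    simp only [Finset.mem_filter, Finset.mem_univ, true_and, Finset.mem_Iio]
    constructor
    · rintro ⟨hj, hlt⟩
      by_contra hcon
      rcases eq_or_lt_of_le (not_lt.1 hcon) with h | h
      · subst h; exact lt_irrefl _ hlt
      · exact lt_asymm hlt (ht i j h (Or.inl hj))
    · intro h
      exact ⟨lt_trans (Fin.lt_def.1 h) hi, ht j i h (Or.inl hi)⟩
  have h2 : (Finset.univ.filter fun j : Fin n => t j < t i).card = t i := by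
    rw [← Fin.card_Iio (t i)]
    exact Finset.card_equiv t fun j => by simp
  rw [← h2]
  conv_lhs => rw [← Fin.card_Iio i, ← h1]
  rw [← Finset.card_union_of_disjoint]
  · congr 1
    ext j
    simp only [Finset.mem_union, Finset.mem_filter, Finset.mem_univ, true_and]
    constructor
    · rintro (h | h) <;> exact h.2
    · intro h
      rcases lt_or_ge (j : ℕ) k with h' | h'
      · exact Or.inr ⟨h', h⟩
      · exact Or.inl ⟨h', h⟩
  · rw [Finset.disjoint_filter]
    intro j _ h h'
    omega

theorem IsBlockIncreasing.le_apply {k n : ℕ} {t : Equiv.Perm (Fin n)}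
    (ht : IsBlockIncreasing k t) {i : Fin n} (hi : (i : ℕ) < k) : (i : ℕ) ≤ t i := by
  have := ht.card_add hi
  omega

theorem IsBlockIncreasing.length_add {k n : ℕ} {t : Equiv.Perm (Fin n)}
    (ht : IsBlockIncreasing k t) :
    length t + ∑ i ∈ firstBlock k n, (i : ℕ) = ∑ i ∈ firstBlock k n, (t i : ℕ) := by
  have h1 : crossInversions k t = ∑ i ∈ firstBlock k n,
      (Finset.univ.filter fun j : Fin n => k ≤ (j : ℕ) ∧ t j < t i).card := by
    rw [← Finset.card_sigma]
    refine Finset.card_equiv (Equiv.sigmaEquivProd _ _).symm fun x => ?_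
    simp [and_assoc]
  rw [ht.length_eq, h1, ← Finset.sum_add_distrib]
  exact Finset.sum_congr rfl fun i hi => ht.card_add (mem_firstBlock.1 hi)

/-- The number of labels `l` with `1 ≤ l ≤ x` and `l ≡ k` modulo `2`. -/
def labelCount (k x : ℕ) : ℕ := ((Finset.Ico 1 (x + 1)).filter fun l => l % 2 = k % 2).card

theorem IsBlockIncreasing.eta_add {k n : ℕ} {t : Equiv.Perm (Fin n)}
    (ht : IsBlockIncreasing k t) :
    eta k t + ∑ i ∈ firstBlock k n, labelCount k i = ∑ i ∈ firstBlock k n, labelCount k (t i) := by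
  have h1 : eta k t = ∑ i ∈ firstBlock k n,
      ((Finset.Ico ((i : ℕ) + 1) ((t i : ℕ) + 1)).filter fun l => l % 2 = k % 2).card := by
    rw [← Finset.card_sigma]
    unfold eta youngDiagram firstBlock
    congr 1
    ext ⟨i, l⟩
    simp [and_assoc]
  rw [h1, ← Finset.sum_add_distrib]
  refine Finset.sum_congr rfl fun i hi => ?_
  have hle := ht.le_apply (mem_firstBlock.1 hi)
  unfold labelCount
  rw [add_comm, ← Finset.card_union_of_disjoint, ← Finset.filter_union,
    Finset.Ico_union_Ico_eq_Ico (by omega) (by omega)]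
  exact Finset.disjoint_filter_filter (Finset.Ico_disjoint_Ico_consecutive _ _ _)

theorem isBlockIncreasing_iff {k l : ℕ} {t : Equiv.Perm (Fin (k + l))} :
    IsBlockIncreasing k t ↔
      StrictMono (fun i => t (Fin.castAdd l i)) ∧ StrictMono (fun i => t (Fin.natAdd k i)) := by
  constructor
  · intro h
    refine ⟨fun i j hij => h _ _ (Fin.strictMono_castAdd l hij) (Or.inl (by simp)),
      fun i j hij => h _ _ (Fin.strictMono_natAdd k hij) (Or.inr (by simp))⟩
  · rintro ⟨h1, h2⟩ a b hab h
    rcases h with h | h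
    · exact h1 (a := ⟨a, lt_trans (Fin.lt_def.1 hab) h⟩) (b := ⟨b, h⟩) hab
    · have hb : k ≤ (b : ℕ) := h.trans (Fin.lt_def.1 hab).le
      have h3 := @h2 ⟨a - k, by omega⟩ ⟨b - k, by omega⟩
        (by rw [Fin.lt_def] at hab ⊢; simp only; omega)
      have ea : Fin.natAdd k (⟨a - k, by omega⟩ : Fin l) = a := Fin.ext (by simp; omega)
      have eb : Fin.natAdd k (⟨b - k, by omega⟩ : Fin l) = b := Fin.ext (by simp; omega)
      simpa only [ea, eb] using h3

theorem firstBlock_eq_map (k l : ℕ) :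
    firstBlock k (k + l) = Finset.univ.map (Fin.castAddEmb l) := by
  ext i
  simp only [mem_firstBlock, Finset.mem_map, Finset.mem_univ, true_and, Fin.castAddEmb_apply]
  constructor
  · intro h; exact ⟨⟨i, h⟩, rfl⟩
  · rintro ⟨j, rfl⟩; simp

/-- A block-increasing permutation is recovered from the set of its values on the first block: that
set and its complement are both listed in increasing order. -/
theorem sum_minimalReps {R : Type*} [CommRing R] (k l : ℕ) (z : Fin (k + l) → R) :
    ∑ w ∈ minimalReps k (k + l), ∏ i ∈ firstBlock k (k + l), z (w i) =
      ∑ S ∈ Finset.powersetCard k (Finset.univ : Finset (Fin (k + l))), ∏ s ∈ S, z s := by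
  classical
  have hcard : (firstBlock k (k + l)).card = k := by simp [firstBlock_eq_map]
  refine Finset.sum_bij (fun w _ => (firstBlock k (k + l)).map w.toEmbedding) ?_ ?_ ?_ ?_
  · intro w _
    simp [Finset.mem_powersetCard, hcard]
  · intro w hw w' hw' h
    rw [mem_minimalReps_iff, isBlockIncreasing_iff] at hw hw'
    have hS : ((firstBlock k (k + l)).map w.toEmbedding).card = k := by simp [hcard]
    have hSc : (((firstBlock k (k + l)).map w.toEmbedding)ᶜ).card = l := by
      rw [Finset.card_compl, hS]; simp
    have e1 := Finset.orderEmbOfFin_unique hS (f := fun i => w (Fin.castAdd l i))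
      (fun i => by simp) hw.1
    have e2 := Finset.orderEmbOfFin_unique hS (f := fun i => w' (Fin.castAdd l i))
      (fun i => by simp [h]) hw'.1
    have e3 := Finset.orderEmbOfFin_unique hSc (f := fun i => w (Fin.natAdd k i))
      (fun i => by simp) hw.2
    have e4 := Finset.orderEmbOfFin_unique hSc (f := fun i => w' (Fin.natAdd k i))
      (fun i => by simp [h]) hw'.2
    ext i
    congr 1
    induction i using Fin.addCases with
    | left i => exact congrFun (e1.trans e2.symm) i
    | right i => exact congrFun (e3.trans e4.symm) i
  · intro S hS
    rw [Finset.mem_powersetCard] at hS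
    have hS1 := hS.2
    have hSc : Sᶜ.card = l := by rw [Finset.card_compl, hS1]; simp
    let w : Equiv.Perm (Fin (k + l)) :=
      finSumFinEquiv.symm.trans (finSumEquivOfFinset hS1 hSc)
    have w1 : ∀ i, w (Fin.castAdd l i) = S.orderEmbOfFin hS1 i := fun i => by simp [w]
    have w2 : ∀ i, w (Fin.natAdd k i) = Sᶜ.orderEmbOfFin hSc i := fun i => by simp [w]
    refine ⟨w, ?_, ?_⟩
    · rw [mem_minimalReps_iff, isBlockIncreasing_iff]
      simp only [w1, w2]
      exact ⟨OrderEmbedding.strictMono _, OrderEmbedding.strictMono _⟩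
    · refine Finset.eq_of_subset_of_card_le (fun x hx => ?_) (by simp [hcard, hS1])
      rw [firstBlock_eq_map, Finset.map_map] at hx
      obtain ⟨i, _, rfl⟩ := Finset.mem_map.1 hx
      simp [w1]
  · intro w _
    simp

/-- The elementary symmetric function of degree `k` of `z 0, …, z (n - 1)`. -/
def elemSymm {R : Type*} [CommRing R] (z : ℕ → R) (n k : ℕ) : R :=
  ∑ S ∈ Finset.powersetCard k (Finset.range n), ∏ s ∈ S, z s

theorem elemSymm_fin {R : Type*} [CommRing R] (z : ℕ → R) (n k : ℕ) :
    ∑ S ∈ Finset.powersetCard k (Finset.univ : Finset (Fin n)), ∏ s ∈ S, z s =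
      elemSymm z n k := by
  unfold elemSymm
  have h : Finset.range n = (Finset.univ : Finset (Fin n)).map Fin.valEmbedding := by
    ext x; simp
  rw [h, Finset.powersetCard_map, Finset.sum_map]
  refine Finset.sum_congr rfl fun S _ => ?_
  simp [Finset.prod_map]

theorem sum_firstBlock {R : Type*} [AddCommMonoid R] (k l : ℕ) (f : ℕ → R) :
    ∑ i ∈ firstBlock k (k + l), f i = ∑ i ∈ Finset.range k, f i := by
  rw [firstBlock_eq_map, Finset.sum_map, ← Fin.sum_univ_eq_sum_range]
  rfl

/-- The factor on the left is the contribution of the identity. It turns the differences in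
`length_add` and `eta_add` into sums over the values `w i`, so that each summand becomes a product
of weights. -/
theorem cellPolynomial_mul (k l : ℕ) :
    cellPolynomial k (k + l) *
      ((-1) ^ (∑ i ∈ Finset.range k, i) * X ^ ∑ i ∈ Finset.range k, labelCount k i) =
    (-1) ^ (k * l) * elemSymm (fun s => (-1) ^ s * (X : ℤ[X]) ^ labelCount k s) (k + l) k := by
  unfold cellPolynomial
  rw [mul_assoc, Nat.add_sub_cancel_left]
  congr 1
  rw [← elemSymm_fin, ← sum_minimalReps k l (fun s => (-1) ^ (s : ℕ) * X ^ labelCount k s),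
    Finset.sum_mul]
  refine Finset.sum_congr rfl fun w hw => ?_
  rw [mem_minimalReps_iff] at hw
  rw [Finset.prod_mul_distrib, Finset.prod_pow_eq_pow_sum, Finset.prod_pow_eq_pow_sum,
    ← hw.length_add, ← hw.eta_add, sum_firstBlock k l (fun i => i),
    sum_firstBlock k l (fun i => labelCount k i)]
  ring

/-! ### Gaussian binomial coefficients and the closed form of the cell polynomial -/

/-- The Gaussian binomial coefficient with upper entry `a + b` and lower entry `a`, at `y`. -/
def gaussBinom {R : Type*} [CommRing R] (y : R) : ℕ → ℕ → R
  | 0, _ => 1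
  | _ + 1, 0 => 1
  | a + 1, b + 1 => gaussBinom y (a + 1) b + y ^ (b + 1) * gaussBinom y a (b + 1)

section

variable {R : Type*} [CommRing R] (y : R)

@[simp] theorem gaussBinom_zero_left (b : ℕ) : gaussBinom y 0 b = 1 := by
  rw [gaussBinom]

@[simp] theorem gaussBinom_zero_right (a : ℕ) : gaussBinom y a 0 = 1 := by
  cases a <;> rw [gaussBinom]

theorem gaussBinom_succ_succ (a b : ℕ) : gaussBinom y (a + 1) (b + 1) =
    gaussBinom y (a + 1) b + y ^ (b + 1) * gaussBinom y a (b + 1) := by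
  rw [gaussBinom]

theorem map_gaussBinom {S : Type*} [CommRing S] (φ : R →+* S) (a b : ℕ) :
    φ (gaussBinom y a b) = gaussBinom (φ y) a b := by
  induction a generalizing b with
  | zero => simp
  | succ a iha =>
    induction b with
    | zero => simp
    | succ b ihb => simp [gaussBinom_succ_succ, iha, ihb]

theorem gaussBinom_succ_left_mul (a b : ℕ) :
    gaussBinom y (a + 1) b * (y ^ (a + 1) - 1) = gaussBinom y a (b + 1) * (y ^ (b + 1) - 1) := by
  induction a generalizing b with
  | zero =>
    induction b with
    | zero => simp
    | succ b ihb =>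
      rw [gaussBinom_succ_succ, add_mul, ihb]
      simp only [gaussBinom_zero_left]
      ring
  | succ a iha =>
    induction b with
    | zero =>
      rw [gaussBinom_succ_succ]
      have := iha 0
      simp only [gaussBinom_zero_right, zero_add, pow_one, one_mul] at this ⊢
      linear_combination y * this
    | succ b ihb =>
      rw [gaussBinom_succ_succ y (a + 1) b, gaussBinom_succ_succ y a (b + 1), add_mul, ihb]
      linear_combination y ^ (b + 2) * iha (b + 1)

/-- This replaces the product formula for Gaussian binomials, and is what raises the lower index in
the counting inductions. -/
theorem gaussBinom_absorb (a b : ℕ) :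
    gaussBinom y (a + 1) b * (y ^ (a + 1) - 1) = gaussBinom y a b * (y ^ (a + b + 1) - 1) := by
  cases b with
  | zero => simp
  | succ b =>
    rw [gaussBinom_succ_succ, add_mul, gaussBinom_succ_left_mul]
    ring

end

/-- In the Pascal recursion the summand multiplied by a power of `X` has strictly larger degree and
supplies the leading term. -/
theorem gaussBinom_monic_natDegree (a b : ℕ) :
    (gaussBinom ((X : ℤ[X]) ^ 2) a b).Monic ∧
      (gaussBinom ((X : ℤ[X]) ^ 2) a b).natDegree = 2 * (a * b) := by
  induction a generalizing b with
  | zero => simp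
  | succ a iha =>
    induction b with
    | zero => simp
    | succ b ihb =>
      rw [gaussBinom_succ_succ, ← pow_mul]
      obtain ⟨h1, h2⟩ := ihb
      obtain ⟨h3, h4⟩ := iha (b + 1)
      have h5 : ((X : ℤ[X]) ^ (2 * (b + 1)) * gaussBinom (X ^ 2) a (b + 1)).Monic :=
        (monic_X_pow _).mul h3
      have h6 : ((X : ℤ[X]) ^ (2 * (b + 1)) * gaussBinom (X ^ 2) a (b + 1)).natDegree =
          2 * ((a + 1) * (b + 1)) := by
        rw [(monic_X_pow _).natDegree_mul h3, h4, natDegree_X_pow]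
        ring
      have h7 : (gaussBinom ((X : ℤ[X]) ^ 2) (a + 1) b).degree <
          ((X : ℤ[X]) ^ (2 * (b + 1)) * gaussBinom (X ^ 2) a (b + 1)).degree := by
        refine degree_lt_degree ?_
        rw [h2, h6]
        nlinarith
      exact ⟨h5.add_of_right h7, by rw [natDegree_add_eq_right_of_degree_lt h7, h6]⟩

section

variable {R : Type*} [CommRing R] (z : ℕ → R)

@[simp] theorem elemSymm_zero_right (n : ℕ) : elemSymm z n 0 = 1 := by
  simp [elemSymm]

theorem elemSymm_eq_zero {n k : ℕ} (h : n < k) : elemSymm z n k = 0 := by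
  unfold elemSymm
  rw [Finset.powersetCard_eq_empty.2 (by simpa using h), Finset.sum_empty]

theorem elemSymm_succ_succ (n k : ℕ) :
    elemSymm z (n + 1) (k + 1) = elemSymm z n (k + 1) + z n * elemSymm z n k := by
  classical
  unfold elemSymm
  have hn : ∀ {i : ℕ} {S : Finset ℕ}, S ∈ Finset.powersetCard i (Finset.range n) → n ∉ S :=
    fun hS h => Finset.notMem_range_self ((Finset.mem_powersetCard.1 hS).1 h)
  rw [Finset.range_add_one, Finset.powersetCard_succ_insert Finset.notMem_range_self,
    Finset.sum_union, Finset.sum_image, Finset.mul_sum]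
  · congr 1
    exact Finset.sum_congr rfl fun S hS => Finset.prod_insert (hn hS)
  · intro S hS T hT h
    rw [← Finset.erase_insert (hn hS), h, Finset.erase_insert (hn hT)]
  · rw [Finset.disjoint_left]
    intro S hS hS'
    obtain ⟨T, _, rfl⟩ := Finset.mem_image.1 hS'
    exact hn hS (Finset.mem_insert_self _ _)

variable {z}

/-- On generating functions, a pair of opposite weights contributes `(1 + zt)(1 - zt) = 1 - z²t²`.
-/
theorem elemSymm_add_two {n : ℕ} (h : z (n + 1) = -z n) (k : ℕ) :
    elemSymm z (n + 2) (k + 2) = elemSymm z n (k + 2) - z n ^ 2 * elemSymm z n k := by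
  rw [elemSymm_succ_succ, elemSymm_succ_succ, elemSymm_succ_succ, h]
  ring

theorem elemSymm_add_two_one {n : ℕ} (h : z (n + 1) = -z n) :
    elemSymm z (n + 2) 1 = elemSymm z n 1 := by
  rw [elemSymm_succ_succ, elemSymm_succ_succ, elemSymm_zero_right, elemSymm_zero_right, h]
  ring

/-- This is the `q`-binomial theorem: the recurrence says that `f m j` is the coefficient of `t^j`
in the product of `1 - x^(2(i + c)) t` over `i < m`. The shift `c` is 0 for the even weights and 1
for the odd ones. -/
theorem eq_gaussBinom_of_recurrence {x : R} {c : ℕ} {f : ℕ → ℕ → R} (h0 : ∀ m, f m 0 = 1)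
    (hlt : ∀ m j, m < j → f m j = 0)
    (hrec : ∀ m j, f (m + 1) (j + 1) = f m (j + 1) - x ^ (2 * (m + c)) * f m j) (j d : ℕ) :
    f (j + d) j = (-1) ^ j * x ^ (∑ i ∈ Finset.range j, 2 * (i + c)) * gaussBinom (x ^ 2) j d := by
  induction j generalizing d with
  | zero => simp [h0]
  | succ j ihj =>
    induction d with
    | zero =>
      have h := ihj 0
      rw [add_zero] at h
      rw [add_zero, hrec, hlt _ _ (Nat.lt_succ_self j), h, Finset.sum_range_succ]
      simp only [gaussBinom_zero_right]
      ring
    | succ d ihd =>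
      have h := ihj (d + 1)
      rw [← add_assoc, hrec, ihd, gaussBinom_succ_succ,
        show j + 1 + d = j + (d + 1) by ring, h, Finset.sum_range_succ]
      ring

end

/-! ### Closed form of the cell polynomial, by parity -/

theorem labelCount_succ (k x : ℕ) :
    labelCount k (x + 1) = labelCount k x + if (x + 1) % 2 = k % 2 then 1 else 0 := by
  unfold labelCount
  rw [← Finset.insert_Ico_right_eq_Ico_add_one (by omega : 1 ≤ x + 1), Finset.filter_insert]
  split_ifs with h
  · rw [Finset.card_insert_of_notMem (by simp)]
  · rfl

theorem labelCount_even {k : ℕ} (hk : k % 2 = 0) (x : ℕ) : labelCount k x = x / 2 := by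
  induction x with
  | zero => simp [labelCount]
  | succ x ih => rw [labelCount_succ, ih]; split_ifs <;> omega

theorem labelCount_odd {k : ℕ} (hk : k % 2 = 1) (x : ℕ) : labelCount k x = (x + 1) / 2 := by
  induction x with
  | zero => simp [labelCount]
  | succ x ih => rw [labelCount_succ, ih]; split_ifs <;> omega

theorem sum_range_even (j : ℕ) :
    ∑ s ∈ Finset.range (2 * j), s / 2 = ∑ i ∈ Finset.range j, 2 * (i + 0) := by
  induction j with
  | zero => rfl
  | succ j ih =>
    rw [show 2 * (j + 1) = 2 * j + 1 + 1 by ring, Finset.sum_range_succ, Finset.sum_range_succ, ih,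
      Finset.sum_range_succ]
    omega

theorem sum_range_odd (j : ℕ) :
    ∑ s ∈ Finset.range (2 * j + 1), (s + 1) / 2 = ∑ i ∈ Finset.range j, 2 * (i + 1) := by
  induction j with
  | zero => rfl
  | succ j ih =>
    rw [show 2 * (j + 1) + 1 = 2 * j + 1 + 1 + 1 by ring, Finset.sum_range_succ,
      Finset.sum_range_succ, ih, Finset.sum_range_succ]
    omega

theorem neg_one_pow_sum_range (j : ℕ) :
    (-1 : ℤ[X]) ^ (∑ s ∈ Finset.range (2 * j), s) = (-1) ^ j ∧
      (-1 : ℤ[X]) ^ (∑ s ∈ Finset.range (2 * j + 1), s) = (-1) ^ j := by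
  have h : (-1 : ℤ[X]) ^ (∑ s ∈ Finset.range (2 * j), s) = (-1) ^ j := by
    induction j with
    | zero => rfl
    | succ j ih =>
      rw [show 2 * (j + 1) = 2 * j + 1 + 1 by ring, Finset.sum_range_succ, Finset.sum_range_succ,
        pow_add, pow_add, ih, pow_succ _ (2 * j), pow_mul]
      simp [pow_succ]
  refine ⟨h, ?_⟩
  rw [Finset.sum_range_succ, pow_add, h, pow_mul]
  simp

/-- The weights `(-1)^s X^⌊s/2⌋`. -/
def evenWeight (s : ℕ) : ℤ[X] := (-1) ^ s * X ^ (s / 2)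

/-- The weights `(-1)^s X^⌈s/2⌉`. -/
def oddWeight (s : ℕ) : ℤ[X] := (-1) ^ s * X ^ ((s + 1) / 2)

theorem evenWeight_two_mul (m : ℕ) : evenWeight (2 * m) = X ^ m := by
  unfold evenWeight
  rw [pow_mul]
  simp

theorem evenWeight_succ (m : ℕ) : evenWeight (2 * m + 1) = -evenWeight (2 * m) := by
  rw [evenWeight_two_mul]
  unfold evenWeight
  rw [pow_succ, pow_mul, show (2 * m + 1) / 2 = m by omega]
  simp

theorem oddWeight_two_mul_add_one (m : ℕ) : oddWeight (2 * m + 1) = -X ^ (m + 1) := by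
  unfold oddWeight
  rw [pow_succ, pow_mul, show (2 * m + 1 + 1) / 2 = m + 1 by omega]
  simp

theorem oddWeight_succ (m : ℕ) : oddWeight (2 * m + 1 + 1) = -oddWeight (2 * m + 1) := by
  rw [oddWeight_two_mul_add_one]
  unfold oddWeight
  rw [pow_succ, pow_succ, pow_mul, show (2 * m + 1 + 1 + 1) / 2 = m + 1 by omega]
  simp

/-- The weights split completely into opposite pairs, so their generating function is even in `t`.
-/
theorem elemSymm_evenWeight_odd (m j : ℕ) : elemSymm evenWeight (2 * m) (2 * j + 1) = 0 := by
  induction m generalizing j with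
  | zero => exact elemSymm_eq_zero _ (by omega)
  | succ m ih =>
    cases j with
    | zero => rw [mul_add, mul_one, elemSymm_add_two_one (evenWeight_succ m)]; exact ih 0
    | succ j =>
      rw [show 2 * (j + 1) + 1 = 2 * j + 1 + 2 by ring, mul_add, mul_one,
        elemSymm_add_two (evenWeight_succ m), ih j]
      have := ih (j + 1)
      rw [show 2 * (j + 1) + 1 = 2 * j + 1 + 2 by ring] at this
      rw [this]
      ring

theorem elemSymm_evenWeight (j d : ℕ) :
    elemSymm evenWeight (2 * (j + d)) (2 * j) =
      (-1) ^ j * X ^ (∑ i ∈ Finset.range j, 2 * (i + 0)) * gaussBinom (X ^ 2) j d := by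
  refine eq_gaussBinom_of_recurrence (f := fun m j => elemSymm evenWeight (2 * m) (2 * j))
    (fun m => by simp) (fun m j h => elemSymm_eq_zero _ (by omega)) (fun m j => ?_) j d
  rw [mul_add, mul_add, mul_one, elemSymm_add_two (evenWeight_succ m), evenWeight_two_mul]
  ring

theorem elemSymm_evenWeight_succ (j d : ℕ) :
    elemSymm evenWeight (2 * (j + d) + 1) (2 * j) = elemSymm evenWeight (2 * (j + d)) (2 * j) := by
  cases j with
  | zero => simp
  | succ j =>
    rw [show 2 * (j + 1) = 2 * j + 1 + 1 by ring, elemSymm_succ_succ, elemSymm_evenWeight_odd]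
    ring

theorem elemSymm_oddWeight_even (j d : ℕ) :
    elemSymm oddWeight (2 * (j + d) + 1) (2 * j) =
      (-1) ^ j * X ^ (∑ i ∈ Finset.range j, 2 * (i + 1)) * gaussBinom (X ^ 2) j d := by
  refine eq_gaussBinom_of_recurrence (f := fun m j => elemSymm oddWeight (2 * m + 1) (2 * j))
    (fun m => by simp) (fun m j h => elemSymm_eq_zero _ (by omega)) (fun m j => ?_) j d
  rw [show 2 * (m + 1) + 1 = 2 * m + 1 + 2 by ring, mul_add, mul_one,
    elemSymm_add_two (oddWeight_succ m), oddWeight_two_mul_add_one]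
  ring

/-- The weight at 0 is an unpaired 1, so the generating function is `1 + t` times an even function;
hence the coefficients in degrees `2j` and `2j + 1` coincide. -/
theorem elemSymm_oddWeight_odd (j d : ℕ) :
    elemSymm oddWeight (2 * (j + d) + 1) (2 * j + 1) =
      (-1) ^ j * X ^ (∑ i ∈ Finset.range j, 2 * (i + 1)) * gaussBinom (X ^ 2) j d := by
  refine eq_gaussBinom_of_recurrence (f := fun m j => elemSymm oddWeight (2 * m + 1) (2 * j + 1))
    (fun m => ?_) (fun m j h => elemSymm_eq_zero _ (by omega)) (fun m j => ?_) j d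
  · induction m with
    | zero => rw [elemSymm_succ_succ, elemSymm_eq_zero _ (by omega)]; simp [oddWeight]
    | succ m ih =>
      rw [show 2 * (m + 1) + 1 = 2 * m + 1 + 2 by ring]
      exact (elemSymm_add_two_one (oddWeight_succ m)).trans ih
  · rw [show 2 * (m + 1) + 1 = 2 * m + 1 + 2 by ring,
      show 2 * (j + 1) + 1 = 2 * j + 1 + 2 by ring,
      elemSymm_add_two (oddWeight_succ m), oddWeight_two_mul_add_one]
    ring

theorem cellPolynomial_even_mul (j l : ℕ) :
    cellPolynomial (2 * j) (2 * j + l) *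
      ((-1) ^ j * X ^ ∑ i ∈ Finset.range j, 2 * (i + 0)) =
    elemSymm evenWeight (2 * j + l) (2 * j) := by
  have h := cellPolynomial_mul (2 * j) l
  simp only [labelCount_even (show 2 * j % 2 = 0 by omega)] at h
  rw [(neg_one_pow_sum_range j).1, sum_range_even] at h
  rw [h, mul_assoc, pow_mul]
  simp only [even_two, Even.neg_pow, one_pow, one_mul]
  rfl

theorem cellPolynomial_odd_mul (j l : ℕ) :
    cellPolynomial (2 * j + 1) (2 * j + 1 + l) *
      ((-1) ^ j * X ^ ∑ i ∈ Finset.range j, 2 * (i + 1)) =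
    (-1) ^ l * elemSymm oddWeight (2 * j + 1 + l) (2 * j + 1) := by
  have h := cellPolynomial_mul (2 * j + 1) l
  simp only [labelCount_odd (show (2 * j + 1) % 2 = 1 by omega)] at h
  rw [(neg_one_pow_sum_range j).2, sum_range_odd] at h
  rw [h, add_mul, one_mul, mul_assoc, pow_add, pow_mul]
  simp only [even_two, Even.neg_pow, one_pow, one_mul]
  rfl

theorem sign_mul_X_pow_ne_zero (j e : ℕ) : (-1 : ℤ[X]) ^ j * X ^ e ≠ 0 :=
  mul_ne_zero (pow_ne_zero _ (neg_ne_zero.2 one_ne_zero)) (pow_ne_zero _ X_ne_zero)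

theorem cellPolynomial_even_even (j d : ℕ) :
    cellPolynomial (2 * j) (2 * j + 2 * d) = gaussBinom (X ^ 2) j d := by
  refine mul_right_cancel₀ (sign_mul_X_pow_ne_zero j _) ((cellPolynomial_even_mul j _).trans ?_)
  rw [← mul_add, elemSymm_evenWeight]
  ring

theorem cellPolynomial_even_odd (j d : ℕ) :
    cellPolynomial (2 * j) (2 * j + (2 * d + 1)) = gaussBinom (X ^ 2) j d := by
  refine mul_right_cancel₀ (sign_mul_X_pow_ne_zero j _) ((cellPolynomial_even_mul j _).trans ?_)
  rw [← add_assoc, ← mul_add, elemSymm_evenWeight_succ, elemSymm_evenWeight]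
  ring

theorem cellPolynomial_odd_even (j d : ℕ) :
    cellPolynomial (2 * j + 1) (2 * j + 1 + 2 * d) = gaussBinom (X ^ 2) j d := by
  refine mul_right_cancel₀ (sign_mul_X_pow_ne_zero j _) ((cellPolynomial_odd_mul j _).trans ?_)
  rw [show 2 * j + 1 + 2 * d = 2 * (j + d) + 1 by ring, elemSymm_oddWeight_odd, pow_mul]
  simp only [even_two, Even.neg_pow, one_pow, one_mul]
  ring

/-- Here the last weight `-X^(j+d+1)` is unpaired too. It multiplies the degree `2j` coefficient,
which equals the degree `2j + 1` one, and so produces the extra factor; the outer sign is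
`(-1)^(2d+1)`. -/
theorem cellPolynomial_odd_odd (j d : ℕ) :
    cellPolynomial (2 * j + 1) (2 * j + 1 + (2 * d + 1)) =
      (X ^ (j + d + 1) - 1) * gaussBinom (X ^ 2) j d := by
  refine mul_right_cancel₀ (sign_mul_X_pow_ne_zero j _) ((cellPolynomial_odd_mul j _).trans ?_)
  rw [show 2 * j + 1 + (2 * d + 1) = 2 * (j + d) + 1 + 1 by ring, elemSymm_succ_succ,
    elemSymm_oddWeight_odd, elemSymm_oddWeight_even, oddWeight_two_mul_add_one, pow_succ, pow_mul]
  simp only [even_two, Even.neg_pow, one_pow, one_mul]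
  ring

theorem natDegree_cellPolynomial_odd_odd (j d : ℕ) :
    ((X ^ (j + d + 1) - 1) * gaussBinom ((X : ℤ[X]) ^ 2) j d).natDegree =
      j + d + 1 + 2 * (j * d) := by
  have h : ((X : ℤ[X]) ^ (j + d + 1) - 1).Monic := monic_X_pow_sub_C 1 (by omega)
  have h2 : ((X : ℤ[X]) ^ (j + d + 1) - 1).natDegree = j + d + 1 :=
    natDegree_X_pow_sub_C (n := j + d + 1) (r := (1 : ℤ))
  rw [h.natDegree_mul (gaussBinom_monic_natDegree j d).1, (gaussBinom_monic_natDegree j d).2, h2]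

/-! ### Symmetric idempotent matrices -/

open Matrix

section

variable {E : Type*} [Field E] {n : ℕ}

/-- Symmetric idempotents, that is, orthogonal projections onto nondegenerate subspaces. -/
structure IsSymmIdem (P : Matrix (Fin n) (Fin n) E) : Prop where
  transpose_eq : Pᵀ = P
  mul_self : P * P = P

/-- `X` has pairwise orthogonal rows with norms `c`, which span the image of `P`. -/
structure IsOrthFrame {k : ℕ} (c : Fin k → E) (X : Matrix (Fin k) (Fin n) E)
    (P : Matrix (Fin n) (Fin n) E) : Prop where
  gram : X * Xᵀ = diagonal c
  proj : Xᵀ * diagonal c⁻¹ * X = P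

theorem diagonal_mul_inv {k : ℕ} {c : Fin k → E} (hc : ∀ i, c i ≠ 0) :
    diagonal c * diagonal c⁻¹ = 1 := by
  rw [diagonal_mul_diagonal, ← diagonal_one]
  congr 1
  ext i
  exact mul_inv_cancel₀ (hc i)

theorem diagonal_inv_mul {k : ℕ} {c : Fin k → E} (hc : ∀ i, c i ≠ 0) :
    diagonal c⁻¹ * diagonal c = 1 := by
  rw [diagonal_mul_diagonal, ← diagonal_one]
  congr 1
  ext i
  exact inv_mul_cancel₀ (hc i)

namespace IsOrthFrame

variable {k : ℕ} {c : Fin k → E} {X : Matrix (Fin k) (Fin n) E} {P : Matrix (Fin n) (Fin n) E}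

theorem mul_proj (h : IsOrthFrame c X P) (hc : ∀ i, c i ≠ 0) : X * P = X := by
  rw [← h.proj, ← Matrix.mul_assoc, ← Matrix.mul_assoc, h.gram, diagonal_mul_inv hc,
    Matrix.one_mul]

theorem isSymmIdem (h : IsOrthFrame c X P) (hc : ∀ i, c i ≠ 0) : IsSymmIdem P where
  transpose_eq := by
    rw [← h.proj, transpose_mul, transpose_mul, diagonal_transpose, transpose_transpose,
      Matrix.mul_assoc]
  mul_self := by
    nth_rw 1 [← h.proj]
    rw [Matrix.mul_assoc, h.mul_proj hc, h.proj]

theorem rank_eq (h : IsOrthFrame c X P) (hc : ∀ i, c i ≠ 0) : P.rank = k := by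
  refine le_antisymm ?_ ?_
  · rw [← h.proj]
    exact (rank_mul_le_right _ _).trans (rank_le_height X)
  · have h1 : (diagonal c).rank = k := by
      rw [rank_of_det_ne_zero, Fintype.card_fin]
      rw [det_diagonal]
      exact Finset.prod_ne_zero_iff.2 fun i _ => hc i
    calc k = (X * P * Xᵀ).rank := by rw [h.mul_proj hc, h.gram, h1]
      _ ≤ (X * P).rank := rank_mul_le_left _ _
      _ ≤ P.rank := rank_mul_le_right _ _

/-- A vector orthogonal to the image of `P` extends the frame. For isotropic `u` the convention `0⁻¹
= 0` makes its contribution to the projection vanish on both sides. -/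
theorem cons (h : IsOrthFrame c X P) (hc : ∀ i, c i ≠ 0) {u : Fin n → E} (hu : P *ᵥ u = 0) :
    IsOrthFrame (Fin.cons (u ⬝ᵥ u) c) (of (Fin.cons u X : Fin (k + 1) → Fin n → E))
      (P + (u ⬝ᵥ u)⁻¹ • vecMulVec u u) where
  gram := by
    have hXu : X *ᵥ u = 0 := by
      rw [← h.mul_proj hc, ← mulVec_mulVec, hu, mulVec_zero]
    have hXu' : ∀ i, X i ⬝ᵥ u = 0 := fun i => congrFun hXu i
    have hg : ∀ i j, X i ⬝ᵥ X j = diagonal c i j := fun i j => by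
      rw [← h.gram]; rfl
    ext i j
    refine Fin.cases ?_ (fun i => ?_) i <;> refine Fin.cases ?_ (fun j => ?_) j
    · rw [diagonal_apply_eq]; rfl
    · rw [diagonal_apply_ne _ (Fin.succ_ne_zero j).symm]
      exact (dotProduct_comm _ _).trans (hXu' j)
    · rw [diagonal_apply_ne _ (Fin.succ_ne_zero i)]
      exact hXu' i
    · rw [diagonal_apply]
      simp only [Fin.succ_inj, Fin.cons_succ]
      rw [← diagonal_apply]
      exact hg i j
  proj := by
    ext a b
    have h1 : P a b = ∑ i, X i a * (c i)⁻¹ * X i b := by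
      rw [← h.proj, Matrix.mul_apply]
      simp [Matrix.mul_diagonal]
    rw [Matrix.add_apply, h1, Matrix.mul_apply, Fin.sum_univ_succ]
    simp only [Matrix.mul_diagonal]
    change u a * (u ⬝ᵥ u)⁻¹ * u b + ∑ i : Fin k, X i a * (c i)⁻¹ * X i b =
      ∑ i, X i a * (c i)⁻¹ * X i b + (u ⬝ᵥ u)⁻¹ * (u a * u b)
    ring

end IsOrthFrame

theorem isOrthFrame_zero (c : Fin 0 → E) (X : Matrix (Fin 0) (Fin n) E) :
    IsOrthFrame c X 0 where
  gram := by ext i; exact i.elim0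
  proj := by ext; simp [Matrix.mul_apply]

namespace IsSymmIdem

variable {P : Matrix (Fin n) (Fin n) E}

/-- Since `Px ⬝ Px = x ⬝ Px`, a totally isotropic image would make the quadratic form of the
symmetric matrix `P` vanish, and polarisation would give `2P = 0`. -/
theorem exists_anisotropic (hP : IsSymmIdem P) (h2 : (2 : E) ≠ 0) (h0 : P ≠ 0) :
    ∃ v, P *ᵥ v = v ∧ v ⬝ᵥ v ≠ 0 := by
  by_contra! hcon
  have key : ∀ x, x ⬝ᵥ P *ᵥ x = 0 := by
    intro x
    have := hcon (P *ᵥ x) (by rw [mulVec_mulVec, hP.mul_self])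
    rwa [dotProduct_mulVec, vecMul_mulVec, hP.transpose_eq, hP.mul_self,
      ← dotProduct_mulVec] at this
  apply h0
  ext i j
  have h1 : ∀ i j, Pi.single i 1 ⬝ᵥ P *ᵥ Pi.single j 1 = P i j := by
    intro i j
    simp
  have hsymm : P j i = P i j := congrFun (congrFun hP.transpose_eq i) j
  have h3 := key (Pi.single i 1 + Pi.single j 1)
  rw [mulVec_add, add_dotProduct, dotProduct_add, dotProduct_add, key, key, h1, h1, hsymm] at h3
  have h4 : 2 * P i j = 0 := by linear_combination h3
  simpa [h2] using h4

variable {u : Fin n → E}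

theorem vecMul_eq (hP : IsSymmIdem P) (hu : P *ᵥ u = u) : u ᵥ* P = u := by
  rw [← hP.transpose_eq, vecMul_transpose, hu]

theorem sub_mulVec_self (hu : P *ᵥ u = u) (hq : u ⬝ᵥ u ≠ 0) :
    (P - (u ⬝ᵥ u)⁻¹ • vecMulVec u u) *ᵥ u = 0 := by
  rw [sub_mulVec, hu, smul_mulVec, vecMulVec_mulVec]
  ext i
  simp
  field_simp
  simp

theorem sub (hP : IsSymmIdem P) (hu : P *ᵥ u = u) (hq : u ⬝ᵥ u ≠ 0) :
    IsSymmIdem (P - (u ⬝ᵥ u)⁻¹ • vecMulVec u u) where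
  transpose_eq := by
    rw [transpose_sub, hP.transpose_eq, transpose_smul, transpose_vecMulVec]
  mul_self := by
    rw [Matrix.mul_sub, Matrix.mul_smul, mul_vecMulVec, sub_mulVec_self hu hq,
      zero_vecMulVec, smul_zero, sub_zero, Matrix.sub_mul, hP.mul_self, Matrix.smul_mul,
      vecMulVec_mul, hP.vecMul_eq hu]

theorem mulVec_of_sub (hP : IsSymmIdem P) (hu : P *ᵥ u = u) {w : Fin n → E}
    (hw : (P - (u ⬝ᵥ u)⁻¹ • vecMulVec u u) *ᵥ w = w) : P *ᵥ w = w := by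
  have h : P * (P - (u ⬝ᵥ u)⁻¹ • vecMulVec u u) = P - (u ⬝ᵥ u)⁻¹ • vecMulVec u u := by
    rw [Matrix.mul_sub, hP.mul_self, Matrix.mul_smul, mul_vecMulVec, hu]
  rw [← hw, mulVec_mulVec, h]

theorem dotProduct_of_sub (hP : IsSymmIdem P) (hu : P *ᵥ u = u) (hq : u ⬝ᵥ u ≠ 0)
    {w : Fin n → E} (hw : (P - (u ⬝ᵥ u)⁻¹ • vecMulVec u u) *ᵥ w = w) : u ⬝ᵥ w = 0 := by
  rw [← hw, dotProduct_mulVec, ← (hP.sub hu hq).transpose_eq, vecMul_transpose,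
    sub_mulVec_self hu hq, zero_dotProduct]

/-- The new image lies in the old one and misses `u`, which the new projection kills. -/
theorem rank_sub_lt (hP : IsSymmIdem P) (hu : P *ᵥ u = u) (hq : u ⬝ᵥ u ≠ 0) :
    (P - (u ⬝ᵥ u)⁻¹ • vecMulVec u u).rank < P.rank := by
  refine Submodule.finrank_lt_finrank_of_lt (SetLike.lt_iff_le_and_exists.2
    ⟨?_, u, LinearMap.mem_range.2 ⟨u, hu⟩, ?_⟩)
  · rintro _ ⟨x, rfl⟩
    refine ⟨_, hP.mulVec_of_sub hu ?_⟩
    simp only [mulVecLin_apply, mulVec_mulVec, (hP.sub hu hq).mul_self]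
  · rintro ⟨x, hx⟩
    have h1 : (P - (u ⬝ᵥ u)⁻¹ • vecMulVec u u) *ᵥ u = u := by
      have h2 := congrArg (fun A => A *ᵥ x) (hP.sub hu hq).mul_self
      simp only [← mulVec_mulVec] at h2
      rw [mulVecLin_apply] at hx
      rwa [hx] at h2
    rw [sub_mulVec_self hu hq] at h1
    rw [← h1] at hq
    simp at hq

end IsSymmIdem

end

/-! ### Orthogonal bases with normalised norms -/

section

variable {E : Type*} [Field E] {n : ℕ}

theorem IsSymmIdem.exists_isOrthFrame_one [IsAlgClosed E] (h2 : (2 : E) ≠ 0)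
    {P : Matrix (Fin n) (Fin n) E} (hP : IsSymmIdem P) :
    ∃ X, IsOrthFrame (fun _ : Fin P.rank => (1 : E)) X P := by
  -- The length of the frame is left free so that the induction avoids the dependent type `Fin
  -- P.rank`; `rank_eq` identifies it afterwards.
  suffices h : ∀ r (P : Matrix (Fin n) (Fin n) E), IsSymmIdem P → P.rank = r →
      ∃ k X, IsOrthFrame (fun _ : Fin k => (1 : E)) X P by
    obtain ⟨k, X, hX⟩ := h _ P hP rfl
    have hk := hX.rank_eq fun _ => one_ne_zero
    rw [hk]
    exact ⟨X, hX⟩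
  intro r
  induction r using Nat.strong_induction_on with
  | _ r ih =>
    intro P hP hr
    by_cases h0 : P = 0
    · subst h0
      exact ⟨0, 0, isOrthFrame_zero _ _⟩
    obtain ⟨v, hv, hq⟩ := hP.exists_anisotropic h2 h0
    obtain ⟨s, hs⟩ := IsAlgClosed.exists_pow_nat_eq (v ⬝ᵥ v) (n := 2) (by norm_num)
    have hs0 : s ≠ 0 := by rintro rfl; exact hq (by rw [← hs]; simp)
    have hu : P *ᵥ (s⁻¹ • v) = s⁻¹ • v := by rw [mulVec_smul, hv]
    have huu : (s⁻¹ • v) ⬝ᵥ (s⁻¹ • v) = 1 := by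
      rw [smul_dotProduct, dotProduct_smul, ← hs, smul_eq_mul, smul_eq_mul]
      field_simp
    generalize s⁻¹ • v = u at hu huu
    have hu0 : u ⬝ᵥ u ≠ 0 := by rw [huu]; exact one_ne_zero
    obtain ⟨k, X, hX⟩ := ih _ (hr ▸ hP.rank_sub_lt hu hu0) _ (hP.sub hu hu0) rfl
    have h := hX.cons (fun _ => one_ne_zero) (IsSymmIdem.sub_mulVec_self hu hu0)
    rw [sub_add_cancel] at h
    have hc : (Fin.cons (u ⬝ᵥ u) fun _ => 1 : Fin (k + 1) → E) = fun _ => 1 := by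
      ext i
      refine Fin.cases ?_ (fun i => ?_) i
      · exact huu
      · rfl
    rw [hc] at h
    exact ⟨k + 1, _, h⟩

/-- The vector `(1, …, 1, c)`. -/
def lastWeight (k : ℕ) (c : E) (i : Fin k) : E := if (i : ℕ) + 1 = k then c else 1

theorem lastWeight_ne_zero {k : ℕ} {c : E} (hc : c ≠ 0) (i : Fin k) : lastWeight k c i ≠ 0 := by
  unfold lastWeight
  split_ifs
  · exact hc
  · exact one_ne_zero

theorem lastWeight_zero (k : ℕ) (c : E) : lastWeight (k + 2) c 0 = 1 := by
  simp [lastWeight]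

theorem lastWeight_succ (k : ℕ) (c : E) (i : Fin k) :
    lastWeight (k + 1) c i.succ = lastWeight k c i := by
  simp [lastWeight]

theorem lastWeight_one_left (c : E) (i : Fin 1) : lastWeight 1 c i = c := by
  simp [lastWeight]

theorem lastWeight_one_right (k : ℕ) (i : Fin k) : lastWeight k (1 : E) i = 1 := by
  simp [lastWeight]

theorem prod_lastWeight (k : ℕ) (c : E) : ∏ i, lastWeight (k + 1) c i = c := by
  induction k with
  | zero => simp [lastWeight]
  | succ k ih => simp [Fin.prod_univ_succ, lastWeight_zero, lastWeight_succ, ih]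

end

theorem ringChar_ne_two {F : Type*} [Field F] (h2 : (2 : F) ≠ 0) : ringChar F ≠ 2 := fun h => h2 (by
  have := ringChar.Nat.cast_ringChar (R := F)
  rw [h] at this
  exact_mod_cast this)

section Finite

variable {F : Type*} [Field F] [Fintype F] {n : ℕ}

theorem isSquare_or_isSquare_mul {δ : F} (hδ : ¬IsSquare δ) (a : F) :
    IsSquare a ∨ IsSquare (δ * a) := by
  classical
  by_contra! hcon
  have hδ0 : δ ≠ 0 := by rintro rfl; exact hδ (IsSquare.zero)
  have h1 := quadraticChar_neg_one_iff_not_isSquare.2 hcon.1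
  have h2 := quadraticChar_neg_one_iff_not_isSquare.2 hcon.2
  have h3 := quadraticChar_neg_one_iff_not_isSquare.2 hδ
  rw [map_mul, h1, h3] at h2
  norm_num at h2

theorem exists_eq_mul_sq {δ : F} (hδ : ¬IsSquare δ) {a : F} (ha : a ≠ 0) :
    ∃ c s : F, (c = 1 ∨ c = δ) ∧ a = c * s ^ 2 ∧ s ≠ 0 := by
  have hδ0 : δ ≠ 0 := by rintro rfl; exact hδ (IsSquare.zero)
  rcases isSquare_or_isSquare_mul hδ a with ⟨s, hs⟩ | ⟨s, hs⟩
  · refine ⟨1, s, Or.inl rfl, by rw [hs]; ring, ?_⟩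
    rintro rfl; exact ha (by simpa using hs)
  · refine ⟨δ, s / δ, Or.inr rfl, ?_, ?_⟩
    · field_simp
      rw [mul_comm, hs]; ring
    · refine div_ne_zero ?_ hδ0
      rintro rfl
      simp [hδ0, ha] at hs

theorem exists_mul_sq_add_mul_sq (h2 : (2 : F) ≠ 0) {a b : F} (ha : a ≠ 0) (hb : b ≠ 0) :
    ∃ x y : F, a * x ^ 2 + b * y ^ 2 = 1 := by
  have hodd : Fintype.card F % 2 = 1 := FiniteField.odd_card_of_char_ne_two (ringChar_ne_two h2)
  obtain ⟨x, y, h⟩ := FiniteField.exists_root_sum_quadratic (R := F)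
    (f := C a * X ^ 2 + C 0 * X + C 0) (g := C b * X ^ 2 + C 0 * X + C (-1))
    (degree_quadratic ha) (degree_quadratic hb) hodd
  refine ⟨x, y, ?_⟩
  simp at h
  linear_combination h

/-- Over a finite field every nondegenerate binary form represents 1. Vectors of norm 1 are split
off until a line remains, whose norm matters only modulo squares. -/
theorem IsSymmIdem.exists_isOrthFrame_lastWeight (h2 : (2 : F) ≠ 0) {δ : F} (hδ : ¬IsSquare δ)
    {k : ℕ} {P : Matrix (Fin n) (Fin n) F} (hP : IsSymmIdem P) (hk : P.rank = k + 1) :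
    ∃ c, (c = 1 ∨ c = δ) ∧ ∃ X, IsOrthFrame (lastWeight (k + 1) c) X P := by
  have hδ0 : δ ≠ 0 := by rintro rfl; exact hδ (IsSquare.zero)
  have hne : ∀ {c : F}, (c = 1 ∨ c = δ) → c ≠ 0 := by
    rintro c (rfl | rfl)
    · exact one_ne_zero
    · exact hδ0
  suffices h : ∀ r (P : Matrix (Fin n) (Fin n) F), IsSymmIdem P → P ≠ 0 → P.rank = r →
      ∃ k c, (c = 1 ∨ c = δ) ∧ ∃ X, IsOrthFrame (lastWeight (k + 1) c) X P by
    obtain ⟨k', c, hc, X, hX⟩ := h _ P hP (by rintro rfl; simp at hk) rfl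
    obtain rfl : k = k' := by
      have := hX.rank_eq (lastWeight_ne_zero (hne hc))
      omega
    exact ⟨c, hc, X, hX⟩
  clear hk hP P k
  intro r
  induction r using Nat.strong_induction_on with
  | _ r ih =>
    intro P hP h0 hr
    obtain ⟨v, hv, hq⟩ := hP.exists_anisotropic h2 h0
    by_cases h1 : P - (v ⬝ᵥ v)⁻¹ • vecMulVec v v = 0
    · obtain ⟨c, s, hc, hs, hs0⟩ := exists_eq_mul_sq hδ hq
      have huu : (s⁻¹ • v) ⬝ᵥ (s⁻¹ • v) = c := by
        rw [smul_dotProduct, dotProduct_smul, hs, smul_eq_mul, smul_eq_mul]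
        field_simp
      have hP' : P = 0 + ((s⁻¹ • v) ⬝ᵥ (s⁻¹ • v))⁻¹ • vecMulVec (s⁻¹ • v) (s⁻¹ • v) := by
        rw [sub_eq_zero.1 h1, huu, hs, zero_add, smul_vecMulVec, vecMulVec_smul, smul_smul,
          smul_smul]
        congr 1
        have := hne hc
        field_simp
      have h := (isOrthFrame_zero (n := n) (lastWeight 0 c) 0).cons (fun i => i.elim0)
        (u := s⁻¹ • v) (by simp)
      rw [← hP'] at h
      have hc' : (Fin.cons ((s⁻¹ • v) ⬝ᵥ (s⁻¹ • v)) (lastWeight 0 c) : Fin 1 → F) =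
          lastWeight 1 c := by
        ext i
        rw [lastWeight_one_left]
        obtain rfl : i = 0 := Fin.fin_one_eq_zero i
        exact huu
      rw [hc'] at h
      exact ⟨0, c, hc, _, h⟩
    · obtain ⟨w, hw, hqw⟩ := (hP.sub hv hq).exists_anisotropic h2 h1
      have hvw := hP.dotProduct_of_sub hv hq hw
      have hwP := hP.mulVec_of_sub hv hw
      obtain ⟨x, y, hxy⟩ := exists_mul_sq_add_mul_sq h2 hq hqw
      have hwv : w ⬝ᵥ v = 0 := by rw [dotProduct_comm]; exact hvw
      have hu : P *ᵥ (x • v + y • w) = x • v + y • w := by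
        rw [mulVec_add, mulVec_smul, mulVec_smul, hv, hwP]
      have huu : (x • v + y • w) ⬝ᵥ (x • v + y • w) = 1 := by
        simp only [add_dotProduct, dotProduct_add, smul_dotProduct, dotProduct_smul, hvw, hwv,
          smul_eq_mul]
        linear_combination hxy
      generalize x • v + y • w = u at hu huu
      have hu0 : u ⬝ᵥ u ≠ 0 := by rw [huu]; exact one_ne_zero
      -- Otherwise the image of `P` would be the line of `u`, which cannot contain the orthogonal
      -- anisotropic vectors `v` and `w`.
      have h3 : P - (u ⬝ᵥ u)⁻¹ • vecMulVec u u ≠ 0 := by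
        intro h3
        rw [huu, inv_one, one_smul, sub_eq_zero] at h3
        rw [h3, vecMulVec_mulVec] at hv hwP
        rw [← hv, ← hwP] at hvw
        rw [← hv] at hq
        rw [← hwP] at hqw
        simp [huu] at hvw hq hqw
        tauto
      obtain ⟨k, c, hc, X, hX⟩ := ih _ (hr ▸ hP.rank_sub_lt hu hu0) _ (hP.sub hu hu0) h3 rfl
      have h := hX.cons (lastWeight_ne_zero (hne hc)) (IsSymmIdem.sub_mulVec_self hu hu0)
      rw [sub_add_cancel] at h
      have hc' : (Fin.cons (u ⬝ᵥ u) (lastWeight (k + 1) c) : Fin (k + 2) → F) =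
          lastWeight (k + 2) c := by
        ext i
        refine Fin.cases ?_ (fun i => ?_) i
        · rw [lastWeight_zero]; exact huu
        · rw [lastWeight_succ]; rfl
      rw [hc'] at h
      exact ⟨k + 1, c, hc, _, h⟩

end Finite

/-! ### Counting vectors of given norm -/

section Count

theorem sum_fin_succ {A : Type*} [Fintype A] {n : ℕ} (f : (Fin (n + 1) → A) → ℤ) :
    ∑ x, f x = ∑ a, ∑ x : Fin n → A, f (Fin.cons a x) := by
  rw [← (Fin.consEquiv fun _ : Fin (n + 1) => A).sum_comp, Fintype.sum_prod_type]
  rfl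

variable {F : Type*} [Field F] [Fintype F]

open Classical in
/-- The number of solutions of `∑ D i * x i ^ 2 = e`. -/
def normCount {n : ℕ} (D : Fin n → F) (e : F) : ℤ :=
  ∑ x : Fin n → F, if ∑ i, D i * x i ^ 2 = e then 1 else 0

theorem normCount_eq_card {n : ℕ} (D : Fin n → F) (e : F) :
    normCount D e = Nat.card {x : Fin n → F // ∑ i, D i * x i ^ 2 = e} := by
  classical
  unfold normCount
  rw [Nat.card_eq_fintype_card, Fintype.card_subtype, Finset.sum_boole]

theorem normCount_succ {n : ℕ} (D : Fin (n + 1) → F) (e : F) :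
    normCount D e = ∑ a, normCount (fun i => D (Fin.succ i)) (e - D 0 * a ^ 2) := by
  unfold normCount
  rw [sum_fin_succ]
  refine Finset.sum_congr rfl fun a _ => Finset.sum_congr rfl fun x _ => ?_
  congr 1
  rw [Fin.sum_univ_succ, Fin.cons_zero, eq_sub_iff_add_eq']
  simp only [Fin.cons_succ]

variable [DecidableEq F]

theorem sum_mul_eq (e : F) :
    (∑ s : F, ∑ t : F, if s * t = e then (1 : ℤ) else 0) =
      Fintype.card F - 1 + if e = 0 then (Fintype.card F : ℤ) else 0 := by
  rw [← Finset.add_sum_erase _ _ (Finset.mem_univ (0 : F))]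
  have h1 : ∀ s ∈ Finset.univ.erase (0 : F), (∑ t : F, if s * t = e then (1 : ℤ) else 0) = 1 := by
    intro s hs
    have hs0 : s ≠ 0 := Finset.ne_of_mem_erase hs
    have : ∀ t, s * t = e ↔ t = e / s := fun t => by
      rw [eq_div_iff hs0, mul_comm]
    simp [this]
  rw [Finset.sum_congr rfl h1]
  have hpos : 1 ≤ Fintype.card F := Fintype.card_pos
  simp only [zero_mul, Finset.sum_const, Finset.card_univ, nsmul_eq_mul, mul_one,
    Finset.card_erase_of_mem (Finset.mem_univ _), Nat.cast_sub hpos, Nat.cast_one, eq_comm (a := e)]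
  split_ifs <;> simp [add_comm]

/-- With `ι² = -1` the form factors as `(a + ιb)(a - ιb)`, so the count is that of a hyperbola. -/
theorem sum_sq_add_sq_eq (h2 : (2 : F) ≠ 0) {ι : F} (hι : ι * ι = -1) (e : F) :
    (∑ a : F, ∑ b : F, if a ^ 2 + b ^ 2 = e then (1 : ℤ) else 0) =
      Fintype.card F - 1 + if e = 0 then (Fintype.card F : ℤ) else 0 := by
  rw [← sum_mul_eq, ← Fintype.sum_prod_type', ← Fintype.sum_prod_type']
  have hι0 : ι ≠ 0 := by rintro rfl; simp at hι
  let φ : F × F ≃ F × F :=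
    { toFun := fun p => (p.1 + ι * p.2, p.1 - ι * p.2)
      invFun := fun p => ((p.1 + p.2) / 2, (p.1 - p.2) / (2 * ι))
      left_inv := fun p => by
        ext <;> simp only <;> field_simp <;> ring
      right_inv := fun p => by
        ext <;> simp only <;> field_simp <;> ring }
  refine Fintype.sum_equiv φ _ _ fun p => ?_
  have : (p.1 + ι * p.2) * (p.1 - ι * p.2) = p.1 ^ 2 + p.2 ^ 2 := by
    linear_combination (-p.2 ^ 2) * hι
  change _ = if (p.1 + ι * p.2) * (p.1 - ι * p.2) = e then (1 : ℤ) else 0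
  rw [this]

theorem normCount_add_two (h2 : (2 : F) ≠ 0) (hsq : IsSquare (-1 : F)) {n : ℕ}
    (D : Fin (n + 2) → F) (h0 : D 0 = 1) (h1 : D 1 = 1) (e : F) :
    normCount D e = (Fintype.card F - 1) * Fintype.card F ^ n +
      Fintype.card F * normCount (fun i => D i.succ.succ) e := by
  obtain ⟨ι, hι⟩ := hsq
  have h : normCount D e = ∑ x : Fin n → F, ∑ a : F, ∑ b : F,
      if a ^ 2 + b ^ 2 = e - ∑ i, D i.succ.succ * x i ^ 2 then (1 : ℤ) else 0 := by
    rw [normCount_succ, Finset.sum_comm]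
    refine Finset.sum_congr rfl fun a _ => ?_
    rw [normCount_succ, Finset.sum_comm]
    refine Finset.sum_congr rfl fun b _ => ?_
    unfold normCount
    refine Finset.sum_congr rfl fun x _ => ?_
    have hx : (∑ i, D i.succ.succ * x i ^ 2 = e - D 0 * a ^ 2 - D (Fin.succ 0) * b ^ 2) ↔
        a ^ 2 + b ^ 2 = e - ∑ i, D i.succ.succ * x i ^ 2 := by
      rw [h0, Fin.succ_zero_eq_one, h1]
      constructor <;> intro h <;> linear_combination h
    simp only [hx]
  rw [h]
  simp_rw [sum_sq_add_sq_eq h2 hι.symm]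
  rw [Finset.sum_add_distrib]
  unfold normCount
  rw [Finset.mul_sum]
  congr 1
  · simp only [Finset.sum_const, Finset.card_univ, Fintype.card_pi, Finset.prod_const,
      Fintype.card_fin, nsmul_eq_mul, Nat.cast_pow]
    ring
  · refine Finset.sum_congr rfl fun x _ => ?_
    simp only [sub_eq_zero, mul_ite, mul_one, mul_zero, eq_comm (a := e)]

theorem card_mul_sq_eq (h2 : (2 : F) ≠ 0) {c : F} (hc : c ≠ 0) (t : F) :
    (∑ y : F, if c * y ^ 2 = t then (1 : ℤ) else 0) =
      1 + quadraticChar F c * quadraticChar F t := by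
  have hF := ringChar_ne_two h2
  have h := quadraticChar_card_sqrts hF (c * t)
  rw [← map_mul, add_comm, ← h, Finset.sum_boole]
  congr 1
  refine Finset.card_equiv (Equiv.mulLeft₀ c hc) fun y => ?_
  simp only [Finset.mem_filter, Finset.mem_univ, true_and, Set.mem_toFinset,
    Set.mem_ofPred_eq]
  change c * y ^ 2 = t ↔ (c * y) ^ 2 = c * t
  rw [mul_pow, pow_two c, mul_assoc, mul_right_inj' hc]

theorem normCount_one (h2 : (2 : F) ≠ 0) {c : F} (hc : c ≠ 0) (e : F) :
    normCount (lastWeight 1 c) e = 1 + quadraticChar F c * quadraticChar F e := by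
  rw [← card_mul_sq_eq h2 hc e]
  unfold normCount
  rw [← (Equiv.funUnique (Fin 1) F).symm.sum_comp]
  refine Finset.sum_congr rfl fun x _ => ?_
  simp [lastWeight_one_left]

/-- The solutions of `a² + b² = e` are counted twice: by the hyperbola formula, and by summing over
`a` the number of square roots of `e - a²`. -/
theorem sum_quadraticChar_sub_sq (h2 : (2 : F) ≠ 0) (hsq : IsSquare (-1 : F)) {e : F}
    (he : e ≠ 0) : ∑ x : F, quadraticChar F (e - x ^ 2) = -1 := by
  obtain ⟨ι, hι⟩ := hsq
  have h1 := sum_sq_add_sq_eq h2 hι.symm e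
  have h3 : ∀ a : F, (∑ b : F, if a ^ 2 + b ^ 2 = e then (1 : ℤ) else 0) =
      1 + quadraticChar F (e - a ^ 2) := by
    intro a
    have := card_mul_sq_eq h2 one_ne_zero (e - a ^ 2)
    simp only [one_mul, map_one, eq_sub_iff_add_eq'] at this
    exact this
  simp_rw [h3, Finset.sum_add_distrib, if_neg he] at h1
  rw [Finset.sum_const, Finset.card_univ, nsmul_eq_mul, mul_one] at h1
  linarith

/-- Induction in steps of two, each removing a hyperbolic plane, from the one- and two-dimensional
cases. -/
theorem normCount_lastWeight (h2 : (2 : F) ≠ 0) (hsq : IsSquare (-1 : F)) {c : F} (hc : c ≠ 0)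
    {e : F} (he : e ≠ 0) (m : ℕ) :
    normCount (lastWeight (2 * m + 1) c) e = (Fintype.card F : ℤ) ^ (2 * m) +
      (Fintype.card F : ℤ) ^ m * (quadraticChar F c * quadraticChar F e) ∧
    normCount (lastWeight (2 * m + 2) c) e = (Fintype.card F : ℤ) ^ (2 * m + 1) -
      (Fintype.card F : ℤ) ^ m * quadraticChar F c := by
  have hstep : ∀ n, normCount (lastWeight (n + 3) c) e =
      (Fintype.card F - 1) * (Fintype.card F : ℤ) ^ (n + 1) +
        Fintype.card F * normCount (lastWeight (n + 1) c) e := by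
    intro n
    rw [normCount_add_two h2 hsq (n := n + 1) _ (by simp [lastWeight]) (by simp [lastWeight])]
    simp only [lastWeight_succ]
  induction m with
  | zero =>
    refine ⟨by simpa using normCount_one h2 hc e, ?_⟩
    rw [normCount_succ]
    simp only [mul_zero, zero_add, pow_one, pow_zero, one_mul, lastWeight_succ,
      lastWeight_zero 0 c]
    simp_rw [normCount_one h2 hc]
    rw [Finset.sum_add_distrib, ← Finset.mul_sum, sum_quadraticChar_sub_sq h2 hsq he]
    simp
    ring
  | succ m ih =>
    constructor
    · rw [show 2 * (m + 1) + 1 = 2 * m + 3 by ring, hstep, ih.1]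
      ring
    · rw [show 2 * (m + 1) + 2 = 2 * m + 1 + 3 by ring, hstep, ih.2]
      ring

end Count

/-! ### Counting orthogonal frames -/

section Reflection

variable {F : Type*} [Field F] {n : ℕ}

/-- The symmetric bilinear form with diagonal Gram matrix `D`. -/
def diagForm (D x y : Fin n → F) : F := ∑ i, D i * x i * y i

theorem diagForm_comm (D x y : Fin n → F) : diagForm D x y = diagForm D y x :=
  Finset.sum_congr rfl fun i _ => by ring

theorem diagForm_add_smul_left (D x y z : Fin n → F) (a : F) :
    diagForm D (x + a • y) z = diagForm D x z + a * diagForm D y z := by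
  unfold diagForm
  rw [Finset.mul_sum, ← Finset.sum_add_distrib]
  exact Finset.sum_congr rfl fun i _ => by simp; ring

theorem diagForm_add_smul_right (D x y z : Fin n → F) (a : F) :
    diagForm D z (x + a • y) = diagForm D z x + a * diagForm D z y := by
  rw [diagForm_comm, diagForm_add_smul_left, diagForm_comm D x, diagForm_comm D y]

theorem diagForm_self (D x : Fin n → F) : diagForm D x x = ∑ i, D i * x i ^ 2 :=
  Finset.sum_congr rfl fun i _ => by ring

/-- The reflection in the hyperplane orthogonal to `z`. -/
def reflect (D z x : Fin n → F) : Fin n → F :=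
  x + (-(2 * diagForm D x z / diagForm D z z)) • z

theorem reflect_involutive (D : Fin n → F) {z : Fin n → F} (hz : diagForm D z z ≠ 0) :
    Function.Involutive (reflect D z) := by
  intro x
  unfold reflect
  rw [diagForm_add_smul_left, add_assoc, ← add_smul]
  have : -(2 * diagForm D x z / diagForm D z z) +
      -(2 * (diagForm D x z + -(2 * diagForm D x z / diagForm D z z) * diagForm D z z) /
        diagForm D z z) = 0 := by
    field_simp
    ring
  rw [this, zero_smul, add_zero]

theorem diagForm_reflect (D : Fin n → F) {z : Fin n → F} (hz : diagForm D z z ≠ 0)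
    (x y : Fin n → F) : diagForm D (reflect D z x) (reflect D z y) = diagForm D x y := by
  unfold reflect
  rw [diagForm_add_smul_left, diagForm_add_smul_right, diagForm_add_smul_right,
    diagForm_comm D z y]
  field_simp
  ring

/-- Witt's theorem for vectors: the reflection along `v - w` sends `v` to `w`, and the one along `v
+ w` sends `v` to `-w`. The norms of `v - w` and `v + w` add up to four times that of `v`, so one of
them is nonzero. -/
theorem exists_isometry (h2 : (2 : F) ≠ 0) (D : Fin n → F) {v w : Fin n → F}
    (hvw : diagForm D v v = diagForm D w w) (hv : diagForm D v v ≠ 0) :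
    ∃ A : (Fin n → F) ≃ (Fin n → F), A v = w ∧
      ∀ x y, diagForm D (A x) (A y) = diagForm D x y := by
  have hz : ∀ a : F, diagForm D (v + a • w) (v + a • w) =
      diagForm D v v * (1 + a ^ 2) + 2 * a * diagForm D v w := by
    intro a
    rw [diagForm_add_smul_left, diagForm_add_smul_right, diagForm_add_smul_right,
      diagForm_comm D w v, ← hvw]
    ring
  have hz' : ∀ a : F, diagForm D v (v + a • w) = diagForm D v v + a * diagForm D v w :=
    fun a => diagForm_add_smul_right _ _ _ _ _
  by_cases h : diagForm D (v + (-1 : F) • w) (v + (-1 : F) • w) = 0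
  · have h' : diagForm D (v + (1 : F) • w) (v + (1 : F) • w) ≠ 0 := by
      intro h'
      rw [hz] at h h'
      have : 2 * (2 * diagForm D v v) = 0 := by linear_combination h + h'
      simp [h2, hv] at this
    have hneg : ∀ x y : Fin n → F, diagForm D (-x) (-y) = diagForm D x y := fun x y =>
      Finset.sum_congr rfl fun i _ => by simp
    refine ⟨(reflect_involutive D h').toPerm.trans (Equiv.neg _), ?_, fun x y => ?_⟩
    · change -(reflect D (v + (1 : F) • w) v) = w
      unfold reflect
      rw [hz] at h' ⊢
      rw [hz']
      have : 2 * (diagForm D v v + 1 * diagForm D v w) /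
          (diagForm D v v * (1 + 1 ^ 2) + 2 * 1 * diagForm D v w) = 1 := by
        rw [div_eq_one_iff_eq h']; ring
      rw [this]
      ext i
      simp
    · change diagForm D (-(reflect D _ x)) (-(reflect D _ y)) = _
      rw [hneg, diagForm_reflect D h']
  · refine ⟨(reflect_involutive D h).toPerm, ?_, fun x y => diagForm_reflect D h x y⟩
    change reflect D (v + (-1 : F) • w) v = w
    unfold reflect
    rw [hz] at h ⊢
    rw [hz']
    have : 2 * (diagForm D v v + -1 * diagForm D v w) /
        (diagForm D v v * (1 + (-1) ^ 2) + 2 * -1 * diagForm D v w) = 1 := by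
      rw [div_eq_one_iff_eq h]; ring
    rw [this]
    ext i
    simp

end Reflection

section Frames

variable {F : Type*} [Field F] {n k : ℕ}

/-- Tuples of vectors that are pairwise orthogonal for `diagForm D` and have norms `E`. -/
def Frames (D : Fin n → F) (E : Fin k → F) : Type _ :=
  {X : Fin k → Fin n → F // ∀ i j, diagForm D (X i) (X j) = diagonal E i j}

theorem forall_fin_succ_gram {B : (Fin n → F) → (Fin n → F) → F} (hB : ∀ x y, B x y = B y x)
    {E : Fin (k + 1) → F} {X : Fin (k + 1) → Fin n → F} :
    (∀ i j, B (X i) (X j) = diagonal E i j) ↔ B (X 0) (X 0) = E 0 ∧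
      (∀ i : Fin k, B (X 0) (X i.succ) = 0) ∧
      ∀ i j : Fin k, B (X i.succ) (X j.succ) = diagonal (fun i : Fin k => E i.succ) i j := by
  constructor
  · intro h
    refine ⟨by simpa using h 0 0, fun i => ?_, fun i j => ?_⟩
    · rw [h, diagonal_apply_ne _ (Fin.succ_ne_zero i).symm]
    · rw [h]
      simp [diagonal_apply]
  · rintro ⟨h1, h2, h3⟩ i j
    refine Fin.cases ?_ (fun i => ?_) i <;> refine Fin.cases ?_ (fun j => ?_) j
    · rw [h1, diagonal_apply_eq]
    · rw [h2, diagonal_apply_ne _ (Fin.succ_ne_zero j).symm]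
    · rw [hB, h2, diagonal_apply_ne _ (Fin.succ_ne_zero i)]
    · rw [h3]
      simp [diagonal_apply]

/-- The frames whose first vector is `v`, with this vector removed. -/
def FramesAt (D : Fin n → F) (E : Fin k → F) (v : Fin n → F) : Type _ :=
  {Y : Fin k → Fin n → F // (∀ i, diagForm D v (Y i) = 0) ∧
    ∀ i j, diagForm D (Y i) (Y j) = diagonal E i j}

/-- A frame is a first vector together with a frame orthogonal to it. -/
def framesEquivSigma (D : Fin n → F) (E : Fin (k + 1) → F) :
    Frames D E ≃ Σ v : {v : Fin n → F // ∑ i, D i * v i ^ 2 = E 0},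
      FramesAt D (fun i : Fin k => E i.succ) v.1 where
  toFun X :=
    have h := (forall_fin_succ_gram (diagForm_comm D)).1 X.2
    ⟨⟨X.1 0, by rw [← diagForm_self]; exact h.1⟩, ⟨fun i => X.1 i.succ, h.2⟩⟩
  invFun p := ⟨Fin.cons p.1.1 p.2.1, (forall_fin_succ_gram (diagForm_comm D)).2
    ⟨by rw [diagForm_self]; exact p.1.2, p.2.2⟩⟩
  left_inv X := Subtype.ext (Fin.cons_self_tail X.1)
  right_inv p := rfl

/-- Isometries transport frames. -/
def framesAtEquiv (D : Fin n → F) (E : Fin k → F) (A : (Fin n → F) ≃ (Fin n → F))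
    (hA : ∀ x y, diagForm D (A x) (A y) = diagForm D x y) (v : Fin n → F) :
    FramesAt D E v ≃ FramesAt D E (A v) :=
  (Equiv.arrowCongr (Equiv.refl (Fin k)) A).subtypeEquiv fun Y => by
    simp [hA]

/-- A frame starting with the first basis vector is a frame in one dimension less. -/
def framesAtSingleEquiv (D : Fin (n + 1) → F) (h0 : D 0 = 1) (E : Fin k → F) :
    FramesAt D E (Pi.single 0 1) ≃ Frames (fun i : Fin n => D i.succ) E where
  toFun Y := ⟨fun i j => Y.1 i j.succ, fun i j => by
    have hY : ∀ i, Y.1 i 0 = 0 := fun i => by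
      simpa [diagForm, Pi.single_apply, h0] using Y.2.1 i
    rw [← Y.2.2]
    unfold diagForm
    rw [Fin.sum_univ_succ, hY]
    simp⟩
  invFun X := ⟨fun i => Fin.cons 0 (X.1 i), fun i => by
      simp [diagForm, Pi.single_apply], fun i j => by
    rw [← X.2]
    unfold diagForm
    rw [Fin.sum_univ_succ]
    simp⟩
  left_inv Y := by
    have hY : ∀ i, Y.1 i 0 = 0 := fun i => by
      simpa [diagForm, Pi.single_apply, h0] using Y.2.1 i
    refine Subtype.ext (funext fun i => funext fun j => ?_)
    refine Fin.cases ?_ (fun j => ?_) j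
    · exact (hY i).symm
    · rfl
  right_inv X := rfl

/-- An isometry moves the first vector of a frame to the first basis vector, so all fibres over the
first vector have the size of the fibre there, and this one lives in the remaining coordinates. -/
theorem card_frames_succ [Fintype F] (h2 : (2 : F) ≠ 0) (D : Fin (n + 1) → F)
    (E : Fin (k + 1) → F) (hD : D 0 = 1) (hE : E 0 = 1) :
    (Nat.card (Frames D E) : ℤ) = normCount D 1 *
      Nat.card (Frames (fun i : Fin n => D i.succ) fun i : Fin k => E i.succ) := by
  have hfib : ∀ v : {v : Fin (n + 1) → F // ∑ i, D i * v i ^ 2 = E 0},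
      Nonempty (FramesAt D (fun i : Fin k => E i.succ) v.1 ≃
        Frames (fun i : Fin n => D i.succ) fun i : Fin k => E i.succ) := by
    rintro ⟨v, hv⟩
    rw [← diagForm_self, hE] at hv
    have he : diagForm D (Pi.single 0 1) (Pi.single 0 1) = 1 := by
      simp [diagForm, Pi.single_apply, hD]
    obtain ⟨A, hA1, hA2⟩ := exists_isometry h2 D (hv.trans he.symm) (by rw [hv]; exact one_ne_zero)
    have e := framesAtEquiv D (fun i : Fin k => E i.succ) A hA2 v
    rw [hA1] at e
    exact ⟨e.trans (framesAtSingleEquiv D hD _)⟩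
  rw [normCount_eq_card, ← hE, ← Nat.cast_mul, ← Nat.card_prod]
  congr 1
  exact Nat.card_congr ((framesEquivSigma D E).trans
    ((Equiv.sigmaCongrRight fun v => (hfib v).some).trans (Equiv.sigmaEquivProd _ _)))

theorem card_frames_one [Fintype F] (D : Fin n → F) (E : Fin 1 → F) :
    (Nat.card (Frames D E) : ℤ) = normCount D (E 0) := by
  rw [normCount_eq_card]
  have : ∀ v : {v : Fin n → F // ∑ i, D i * v i ^ 2 = E 0},
      Unique (FramesAt D (fun i : Fin 0 => E i.succ) v.1) := fun v =>
    { default := ⟨fun i => i.elim0, fun i => i.elim0, fun i => i.elim0⟩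
      uniq := fun Y => Subtype.ext (funext fun i => i.elim0) }
  congr 1
  exact Nat.card_congr ((framesEquivSigma D E).trans (Equiv.sigmaUnique _ _))

end Frames

/-! ### Counting symmetric idempotents with a frame of given norms -/

section

variable {F : Type*} [Field F] {n k : ℕ}

theorem gram_iff (D : Fin n → F) (E : Fin k → F) (X : Matrix (Fin k) (Fin n) F) :
    (∀ i j, diagForm D (X i) (X j) = diagonal E i j) ↔ X * diagonal D * Xᵀ = diagonal E := by
  have h : ∀ i j, (X * diagonal D * Xᵀ) i j = diagForm D (X i) (X j) := fun i j => by
    rw [Matrix.mul_apply]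
    refine Finset.sum_congr rfl fun a _ => ?_
    rw [Matrix.mul_diagonal, transpose_apply, mul_comm (X i a)]
  constructor
  · intro hX
    ext i j
    rw [h, hX]
  · intro hX i j
    rw [← h, hX]

instance [Finite F] (D : Fin n → F) (E : Fin k → F) : Finite (Frames D E) :=
  Subtype.finite

theorem IsOrthFrame.isometry_mul {c : Fin k → F} (hc : ∀ i, c i ≠ 0)
    {X₀ : Matrix (Fin k) (Fin n) F} {P : Matrix (Fin n) (Fin n) F} (h₀ : IsOrthFrame c X₀ P)
    {B : Matrix (Fin k) (Fin k) F} (hB : B * diagonal c * Bᵀ = diagonal c) :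
    IsOrthFrame c (B * X₀) P where
  gram := by
    rw [transpose_mul]
    calc B * X₀ * (X₀ᵀ * Bᵀ) = B * (X₀ * X₀ᵀ) * Bᵀ := by simp only [Matrix.mul_assoc]
      _ = diagonal c := by rw [h₀.gram, hB]
  proj := by
    have h1 : B * (diagonal c * Bᵀ * diagonal c⁻¹) = 1 := by
      calc B * (diagonal c * Bᵀ * diagonal c⁻¹) = B * diagonal c * Bᵀ * diagonal c⁻¹ := by
            simp only [Matrix.mul_assoc]
        _ = 1 := by rw [hB, diagonal_mul_inv hc]
    -- A one-sided inverse of a square matrix is two-sided; this converts preservation of `c` by `B`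
    -- into preservation of `c⁻¹` by `Bᵀ`.
    have h2 : diagonal c * Bᵀ * diagonal c⁻¹ * B = 1 := mul_eq_one_comm.1 h1
    have h3 : Bᵀ * diagonal c⁻¹ * B = diagonal c⁻¹ := by
      calc Bᵀ * diagonal c⁻¹ * B
          = diagonal c⁻¹ * diagonal c * (Bᵀ * diagonal c⁻¹ * B) := by
            rw [diagonal_inv_mul hc, Matrix.one_mul]
        _ = diagonal c⁻¹ * (diagonal c * Bᵀ * diagonal c⁻¹ * B) := by
            simp only [Matrix.mul_assoc]
        _ = diagonal c⁻¹ := by rw [h2, Matrix.mul_one]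
    rw [transpose_mul]
    calc X₀ᵀ * Bᵀ * diagonal c⁻¹ * (B * X₀) = X₀ᵀ * (Bᵀ * diagonal c⁻¹ * B) * X₀ := by
          simp only [Matrix.mul_assoc]
      _ = P := by rw [h3, h₀.proj]

/-- Two frames of the same idempotent differ by an isometry. -/
def IsOrthFrame.equivIsometries {c : Fin k → F} (hc : ∀ i, c i ≠ 0)
    {X₀ : Matrix (Fin k) (Fin n) F} {P : Matrix (Fin n) (Fin n) F} (h₀ : IsOrthFrame c X₀ P) :
    {X : Matrix (Fin k) (Fin n) F // IsOrthFrame c X P} ≃ Frames c c where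
  -- The matrix of coordinates of the rows of `X` in the basis formed by the rows of `X₀`.
  toFun X := ⟨(X.1 * X₀ᵀ * diagonal c⁻¹ : Matrix (Fin k) (Fin k) F), (gram_iff c c _).2 <| by
    have h1 : X.1 * X₀ᵀ * diagonal c⁻¹ * diagonal c = X.1 * X₀ᵀ := by
      rw [Matrix.mul_assoc, diagonal_inv_mul hc, Matrix.mul_one]
    rw [h1, transpose_mul, transpose_mul, diagonal_transpose, transpose_transpose]
    calc X.1 * X₀ᵀ * (diagonal c⁻¹ * (X₀ * X.1ᵀ))
        = X.1 * (X₀ᵀ * diagonal c⁻¹ * X₀) * X.1ᵀ := by simp only [Matrix.mul_assoc]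
      _ = diagonal c := by rw [h₀.proj, X.2.mul_proj hc, X.2.gram]⟩
  invFun A := ⟨of A.1 * X₀, h₀.isometry_mul hc ((gram_iff c c _).1 A.2)⟩
  left_inv X := Subtype.ext <| by
    change X.1 * X₀ᵀ * diagonal c⁻¹ * X₀ = X.1
    calc X.1 * X₀ᵀ * diagonal c⁻¹ * X₀ = X.1 * (X₀ᵀ * diagonal c⁻¹ * X₀) := by
          simp only [Matrix.mul_assoc]
      _ = X.1 := by rw [h₀.proj, X.2.mul_proj hc]
  right_inv A := Subtype.ext <| by
    change of A.1 * X₀ * X₀ᵀ * diagonal c⁻¹ = of A.1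
    rw [Matrix.mul_assoc (of A.1), h₀.gram, Matrix.mul_assoc,
      diagonal_mul_inv hc, Matrix.mul_one]

/-- The number of orthogonal projections whose image has an orthogonal basis with norms `c`. -/
def projCount (n : ℕ) (c : Fin k → F) : ℕ :=
  Nat.card {P : Matrix (Fin n) (Fin n) F // ∃ X, IsOrthFrame c X P}

/-- Frames in `F^n` fibre over the projections they define, and each fibre is in bijection with the
isometries of `c`. -/
theorem projCount_mul {c : Fin k → F} (hc : ∀ i, c i ≠ 0) :
    (projCount n c : ℤ) * Nat.card (Frames c c) = Nat.card (Frames (lastWeight n (1 : F)) c) := by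
  unfold projCount
  rw [← Nat.cast_mul, ← Nat.card_prod]
  congr 1
  symm
  have hgram : ∀ X : Matrix (Fin k) (Fin n) F,
      (∀ i j, diagForm (lastWeight n (1 : F)) (X i) (X j) = diagonal c i j) ↔
        X * Xᵀ = diagonal c := fun X => by
    have h1 : (diagonal (lastWeight n (1 : F))) = 1 := by
      rw [← diagonal_one]
      congr 1
      ext i
      exact lastWeight_one_right n i
    rw [gram_iff, h1, Matrix.mul_one]
  let e : Frames (lastWeight n (1 : F)) c ≃
      Σ P : {P : Matrix (Fin n) (Fin n) F // ∃ X, IsOrthFrame c X P},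
        {X : Matrix (Fin k) (Fin n) F // IsOrthFrame c X P.1} :=
    { toFun := fun X =>
        have h : IsOrthFrame c (X.1 : Matrix (Fin k) (Fin n) F) _ := ⟨(hgram X.1).1 X.2, rfl⟩
        ⟨⟨_, X.1, h⟩, X.1, h⟩
      invFun := fun p => ⟨p.2.1, (hgram p.2.1).2 p.2.2.gram⟩
      left_inv := fun X => rfl
      right_inv := by
        rintro ⟨⟨P, hP⟩, X, hX⟩
        obtain rfl := hX.proj
        rfl }
  exact Nat.card_congr (e.trans ((Equiv.sigmaCongrRight fun P =>
    IsOrthFrame.equivIsometries hc P.2.choose_spec).trans (Equiv.sigmaEquivProd _ _)))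

/-- The number of symmetric idempotents of rank `k`. -/
def idemCount (F : Type*) [Field F] (n k : ℕ) : ℕ :=
  Nat.card {P : Matrix (Fin n) (Fin n) F // IsSymmIdem P ∧ P.rank = k}

theorem idemCount_zero : idemCount F n 0 = 1 := by
  unfold idemCount
  rw [Nat.card_eq_one_iff_unique]
  refine ⟨⟨?_⟩, ⟨⟨0, ⟨by simp, by simp⟩, by simp⟩⟩⟩
  rintro ⟨P, -, hP⟩ ⟨Q, -, hQ⟩
  rw [Matrix.rank, Submodule.finrank_eq_zero, LinearMap.range_eq_bot] at hP hQ
  have key : ∀ R : Matrix (Fin n) (Fin n) F, R.mulVecLin = 0 → R = 0 := fun R hR => by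
    ext i j
    have := congrFun (LinearMap.congr_fun hR (Pi.single j 1)) i
    simpa using this
  exact Subtype.ext ((key P hP).trans (key Q hQ).symm)

variable [Fintype F]

theorem card_isometries_ne_zero (c : Fin k → F) : (Nat.card (Frames c c) : ℤ) ≠ 0 := by
  have : Nonempty (Frames c c) := ⟨⟨(1 : Matrix (Fin k) (Fin k) F), (gram_iff c c _).2 (by simp)⟩⟩
  exact_mod_cast Nat.card_pos.ne'

theorem projCount_succ (h2 : (2 : F) ≠ 0) {c : F} (hc : c ≠ 0) :
    (projCount (n + 1) (lastWeight (k + 2) c) : ℤ) * normCount (lastWeight (k + 2) c) 1 =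
      normCount (lastWeight (n + 1) (1 : F)) 1 * projCount n (lastWeight (k + 1) c) := by
  have e1 := projCount_mul (n := n + 1) (lastWeight_ne_zero (k := k + 2) hc)
  have e2 := projCount_mul (n := n) (lastWeight_ne_zero (k := k + 1) hc)
  have e3 := card_frames_succ h2 (lastWeight (k + 2) c) (lastWeight (k + 2) c)
    (lastWeight_zero k c) (lastWeight_zero k c)
  have e4 := card_frames_succ h2 (lastWeight (n + 1) (1 : F)) (lastWeight (k + 2) c)
    (lastWeight_one_right _ _) (lastWeight_zero k c)
  simp only [lastWeight_succ] at e3 e4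
  have h0 := card_isometries_ne_zero (lastWeight (k + 1) c)
  rw [e3, e4, ← e2] at e1
  refine mul_right_cancel₀ h0 ?_
  linear_combination e1

/-- The factor 2 counts the isometries `±1` of a line. -/
theorem projCount_one (h2 : (2 : F) ≠ 0) {c : F} (hc : c ≠ 0) :
    (projCount n (lastWeight 1 c) : ℤ) * 2 = normCount (lastWeight n (1 : F)) c := by
  classical
  have e1 := projCount_mul (n := n) (lastWeight_ne_zero (k := 1) hc)
  have e2 := card_frames_one (lastWeight 1 c) (lastWeight 1 c)
  have e3 := card_frames_one (lastWeight n (1 : F)) (lastWeight 1 c)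
  rw [lastWeight_one_left] at e2 e3
  rw [normCount_one h2 hc, ← pow_two, quadraticChar_sq_one hc] at e2
  rw [e2, e3] at e1
  exact e1

theorem idemCount_succ (h2 : (2 : F) ≠ 0) {δ : F} (hδ : ¬IsSquare δ) :
    idemCount F n (k + 1) =
      projCount n (lastWeight (k + 1) (1 : F)) + projCount n (lastWeight (k + 1) δ) := by
  have hδ0 : δ ≠ 0 := by rintro rfl; exact hδ IsSquare.zero
  have hne : ∀ {c : F}, (c = 1 ∨ c = δ) → ∀ i, lastWeight (k + 1) c i ≠ 0 := by
    rintro c (rfl | rfl)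
    · exact lastWeight_ne_zero one_ne_zero
    · exact lastWeight_ne_zero hδ0
  unfold idemCount projCount
  have hiff : ∀ P : Matrix (Fin n) (Fin n) F, (IsSymmIdem P ∧ P.rank = k + 1) ↔
      ((∃ X, IsOrthFrame (lastWeight (k + 1) (1 : F)) X P) ∨
        ∃ X, IsOrthFrame (lastWeight (k + 1) δ) X P) := by
    intro P
    constructor
    · rintro ⟨h, hr⟩
      obtain ⟨c, rfl | rfl, X, hX⟩ := h.exists_isOrthFrame_lastWeight h2 hδ hr
      · exact Or.inl ⟨X, hX⟩
      · exact Or.inr ⟨X, hX⟩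
    · rintro (⟨X, hX⟩ | ⟨X, hX⟩)
      · exact ⟨hX.isSymmIdem (hne (Or.inl rfl)), hX.rank_eq (hne (Or.inl rfl))⟩
      · exact ⟨hX.isSymmIdem (hne (Or.inr rfl)), hX.rank_eq (hne (Or.inr rfl))⟩
  have hdisj : ∀ P : Matrix (Fin n) (Fin n) F,
      (∃ X, IsOrthFrame (lastWeight (k + 1) (1 : F)) X P) →
        ¬∃ X, IsOrthFrame (lastWeight (k + 1) δ) X P := by
    rintro P ⟨X, hX⟩ ⟨Y, hY⟩
    have h1 : diagonal (lastWeight (k + 1) (1 : F))⁻¹ = 1 := by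
      rw [← diagonal_one]
      congr 1
      ext i
      simp [lastWeight_one_right]
    -- Frames of both types in one subspace would have a transition matrix whose squared determinant
    -- is `δ`.
    have h4 : Y * Xᵀ * (Y * Xᵀ)ᵀ = diagonal (lastWeight (k + 1) δ) := by
      have hp := hX.proj
      rw [h1, Matrix.mul_one] at hp
      rw [transpose_mul, transpose_transpose]
      calc Y * Xᵀ * (X * Yᵀ) = Y * (Xᵀ * X) * Yᵀ := by simp only [Matrix.mul_assoc]
        _ = _ := by rw [hp, hY.mul_proj (hne (Or.inr rfl)), hY.gram]
    have h5 := congrArg det h4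
    rw [det_mul, det_transpose, det_diagonal, prod_lastWeight] at h5
    exact hδ ⟨_, h5.symm⟩
  classical
  rw [Nat.card_congr (Equiv.subtypeEquivRight hiff), Nat.card_eq_fintype_card,
    Nat.card_eq_fintype_card, Nat.card_eq_fintype_card, Fintype.card_subtype_or_disjoint]
  rw [Pi.disjoint_iff]
  intro P
  rw [Prop.disjoint_iff]
  exact not_and.2 (hdisj P)

end

/-! ### The number of symmetric idempotents of given rank -/

section

variable {F : Type*} [Field F] [Fintype F]

theorem two_le_card : (2 : ℤ) ≤ Fintype.card F := by
  exact_mod_cast Fintype.one_lt_card (α := F)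

theorem card_pow_ne_zero (m : ℕ) : (Fintype.card F : ℤ) ^ m ≠ 0 :=
  pow_ne_zero _ (by have := two_le_card (F := F); omega)

theorem card_pow_add_ne_zero (m : ℕ) {s : ℤ} (hs : s = 1 ∨ s = -1) :
    (Fintype.card F : ℤ) ^ (m + 1) + s ≠ 0 := by
  have h1 : (2 : ℤ) ≤ (Fintype.card F : ℤ) ^ (m + 1) :=
    (two_le_card (F := F)).trans (le_self_pow₀ (by have := two_le_card (F := F); omega) (by omega))
  rcases hs with rfl | rfl <;> omega

/-- Rank and dimension are raised together by `projCount_succ`, so odd and even ranks alternate in a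
single induction on `j` with `d` fixed. In even rank a factor stays on the left to avoid division;
going to the next odd rank, it combines with its conjugate into `q^(2(j+1)) - 1`, which
`gaussBinom_absorb` removes. -/
theorem projCount_even_codim [DecidableEq F] (h2 : (2 : F) ≠ 0) (hsq : IsSquare (-1 : F))
    {c : F} (hc : c ≠ 0) (j d : ℕ) :
    2 * (projCount (2 * j + 1 + 2 * d) (lastWeight (2 * j + 1) c) : ℤ) =
      (Fintype.card F : ℤ) ^ ((2 * j + 1) * d) *
        ((Fintype.card F : ℤ) ^ d + quadraticChar F c) *
          gaussBinom ((Fintype.card F : ℤ) ^ 2) j d ∧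
    2 * (projCount (2 * j + 2 + 2 * d) (lastWeight (2 * j + 2) c) : ℤ) *
        ((Fintype.card F : ℤ) ^ (j + 1) - quadraticChar F c) =
      (Fintype.card F : ℤ) ^ (2 * (j + 1) * d) * ((Fintype.card F : ℤ) ^ (j + d + 1) - 1) *
        ((Fintype.card F : ℤ) ^ d + quadraticChar F c) *
          gaussBinom ((Fintype.card F : ℤ) ^ 2) j d := by
  have hnorm : ∀ m, _ := fun m => normCount_lastWeight h2 hsq hc (one_ne_zero (α := F)) m
  have hnorm1 : ∀ m, _ := fun m => normCount_lastWeight h2 hsq (one_ne_zero (α := F))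
    (one_ne_zero (α := F)) m
  have hbase : ∀ m, _ := fun m => (normCount_lastWeight h2 hsq (one_ne_zero (α := F)) hc m).1
  have hχ := quadraticChar_dichotomy hc
  have hχ2 := quadraticChar_sq_one hc
  simp only [map_one, one_mul, mul_one] at hnorm hnorm1 hbase
  generalize quadraticChar F c = ε at hnorm hbase hχ hχ2 ⊢
  have hq0 := card_pow_ne_zero (F := F)
  have hq1 := card_pow_add_ne_zero (F := F)
  generalize (Fintype.card F : ℤ) = q at hnorm hnorm1 hbase hq0 hq1 ⊢
  have hodd_even : ∀ j, 2 * (projCount (2 * j + 1 + 2 * d) (lastWeight (2 * j + 1) c) : ℤ) =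
      q ^ ((2 * j + 1) * d) * (q ^ d + ε) * gaussBinom (q ^ 2) j d →
      2 * (projCount (2 * j + 2 + 2 * d) (lastWeight (2 * j + 2) c) : ℤ) * (q ^ (j + 1) - ε) =
      q ^ (2 * (j + 1) * d) * (q ^ (j + d + 1) - 1) * (q ^ d + ε) * gaussBinom (q ^ 2) j d := by
    intro j h
    have hs := projCount_succ (n := 2 * j + 1 + 2 * d) (k := 2 * j) h2 hc
    rw [(hnorm j).2, show 2 * j + 1 + 2 * d + 1 = 2 * (j + d) + 2 by ring, (hnorm1 _).2] at hs
    rw [show 2 * j + 2 + 2 * d = 2 * (j + d) + 2 by ring]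
    refine mul_left_cancel₀ (hq0 j) ?_
    linear_combination 2 * hs + (q ^ (2 * (j + d) + 1) - q ^ (j + d)) * h
  have hodd : 2 * (projCount (2 * j + 1 + 2 * d) (lastWeight (2 * j + 1) c) : ℤ) =
      q ^ ((2 * j + 1) * d) * (q ^ d + ε) * gaussBinom (q ^ 2) j d := by
    induction j with
    | zero =>
      have h := projCount_one (n := 2 * d + 1) h2 hc
      rw [hbase] at h
      rw [show 2 * 0 + 1 + 2 * d = 2 * d + 1 by ring, gaussBinom_zero_left]
      linear_combination h
    | succ j ih =>
      have h := hodd_even j ih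
      have hs := projCount_succ (n := 2 * j + 2 + 2 * d) (k := 2 * j + 1) h2 hc
      have e1 := (hnorm (j + 1)).1
      have hb := gaussBinom_absorb (q ^ 2) j d
      rw [show 2 * (j + 1) + 1 = 2 * j + 1 + 2 by ring] at e1
      rw [e1, show 2 * j + 2 + 2 * d + 1 = 2 * (j + d + 1) + 1 by ring, (hnorm1 _).1] at hs
      rw [show 2 * (j + 1) + 1 + 2 * d = 2 * (j + d + 1) + 1 by ring,
        show 2 * (j + 1) + 1 = 2 * j + 1 + 2 by ring]
      have hne : q ^ (j + 1) * (q ^ (j + 1) + ε) * (q ^ (j + 1) - ε) ≠ 0 := by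
        refine mul_ne_zero (mul_ne_zero (hq0 _) (hq1 j hχ)) ?_
        rw [sub_eq_add_neg]
        exact hq1 j (by rcases hχ with h | h <;> simp [h])
      refine mul_right_cancel₀ hne ?_
      have e2 : (q ^ (j + 1) + ε) * (q ^ (j + 1) - ε) = (q ^ 2) ^ (j + 1) - 1 := by
        linear_combination -hχ2
      linear_combination 2 * (q ^ (j + 1) - ε) * hs +
        (q ^ (2 * (j + d + 1)) + q ^ (j + d + 1)) * h -
        q ^ ((2 * (j + 1) + 1) * d) * (q ^ d + ε) * q ^ (j + 1) *
          gaussBinom (q ^ 2) (j + 1) d * e2 -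
        q ^ ((2 * (j + 1) + 1) * d) * (q ^ d + ε) * q ^ (j + 1) * hb
  exact ⟨hodd, hodd_even j hodd⟩

theorem projCount_odd_codim [DecidableEq F] (h2 : (2 : F) ≠ 0) (hsq : IsSquare (-1 : F))
    {c : F} (hc : c ≠ 0) (j d : ℕ) :
    2 * (projCount (2 * j + 1 + (2 * d + 1)) (lastWeight (2 * j + 1) c) : ℤ) =
      (Fintype.card F : ℤ) ^ (2 * j * d + j + d) * ((Fintype.card F : ℤ) ^ (j + d + 1) - 1) *
          gaussBinom ((Fintype.card F : ℤ) ^ 2) j d ∧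
    2 * (projCount (2 * j + 2 + (2 * d + 1)) (lastWeight (2 * j + 2) c) : ℤ) =
      (Fintype.card F : ℤ) ^ (2 * j * d + j + 2 * d + 1) *
        ((Fintype.card F : ℤ) ^ (j + 1) + quadraticChar F c) *
          gaussBinom ((Fintype.card F : ℤ) ^ 2) (j + 1) d := by
  have hnorm : ∀ m, _ := fun m => normCount_lastWeight h2 hsq hc (one_ne_zero (α := F)) m
  have hnorm1 : ∀ m, _ := fun m => normCount_lastWeight h2 hsq (one_ne_zero (α := F))
    (one_ne_zero (α := F)) m
  have hbase : ∀ m, _ := fun m => (normCount_lastWeight h2 hsq (one_ne_zero (α := F)) hc m).2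
  have hχ := quadraticChar_dichotomy hc
  have hχ2 := quadraticChar_sq_one hc
  simp only [map_one, mul_one] at hnorm hnorm1 hbase
  generalize quadraticChar F c = ε at hnorm hχ hχ2 ⊢
  have hq0 := card_pow_ne_zero (F := F)
  have hq1 := card_pow_add_ne_zero (F := F)
  generalize (Fintype.card F : ℤ) = q at hnorm hnorm1 hbase hq0 hq1 ⊢
  have hodd_even : ∀ j, 2 * (projCount (2 * j + 1 + (2 * d + 1)) (lastWeight (2 * j + 1) c) : ℤ) =
      q ^ (2 * j * d + j + d) * (q ^ (j + d + 1) - 1) * gaussBinom (q ^ 2) j d →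
      2 * (projCount (2 * j + 2 + (2 * d + 1)) (lastWeight (2 * j + 2) c) : ℤ) =
      q ^ (2 * j * d + j + 2 * d + 1) * (q ^ (j + 1) + ε) * gaussBinom (q ^ 2) (j + 1) d := by
    intro j h
    have hs := projCount_succ (n := 2 * j + 1 + (2 * d + 1)) (k := 2 * j) h2 hc
    have hb := gaussBinom_absorb (q ^ 2) j d
    rw [(hnorm j).2, show 2 * j + 1 + (2 * d + 1) + 1 = 2 * (j + d + 1) + 1 by ring,
      (hnorm1 _).1] at hs
    rw [show 2 * j + 2 + (2 * d + 1) = 2 * (j + d + 1) + 1 by ring]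
    have hne : q ^ j * (q ^ (j + 1) - ε) ≠ 0 := by
      refine mul_ne_zero (hq0 _) ?_
      rw [sub_eq_add_neg]
      exact hq1 j (by rcases hχ with h | h <;> simp [h])
    refine mul_right_cancel₀ hne ?_
    have e2 : (q ^ (j + 1) + ε) * (q ^ (j + 1) - ε) = (q ^ 2) ^ (j + 1) - 1 := by
      linear_combination -hχ2
    linear_combination 2 * hs + (q ^ (2 * (j + d + 1)) + q ^ (j + d + 1)) * h -
      q ^ (2 * j * d + j + 2 * d + 1) * q ^ j * gaussBinom (q ^ 2) (j + 1) d * e2 -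
      q ^ (2 * j * d + j + 2 * d + 1) * q ^ j * hb
  have hodd : 2 * (projCount (2 * j + 1 + (2 * d + 1)) (lastWeight (2 * j + 1) c) : ℤ) =
      q ^ (2 * j * d + j + d) * (q ^ (j + d + 1) - 1) * gaussBinom (q ^ 2) j d := by
    induction j with
    | zero =>
      have h := projCount_one (n := 2 * d + 2) h2 hc
      rw [hbase] at h
      rw [show 2 * 0 + 1 + (2 * d + 1) = 2 * d + 2 by ring, gaussBinom_zero_left]
      linear_combination h
    | succ j ih =>
      have h := hodd_even j ih
      have hs := projCount_succ (n := 2 * j + 2 + (2 * d + 1)) (k := 2 * j + 1) h2 hc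
      have e1 := (hnorm (j + 1)).1
      rw [show 2 * (j + 1) + 1 = 2 * j + 1 + 2 by ring] at e1
      rw [e1, show 2 * j + 2 + (2 * d + 1) + 1 = 2 * (j + d + 1) + 2 by ring, (hnorm1 _).2] at hs
      rw [show 2 * (j + 1) + 1 + (2 * d + 1) = 2 * (j + d + 1) + 2 by ring,
        show 2 * (j + 1) + 1 = 2 * j + 1 + 2 by ring]
      have hne : q ^ (j + 1) * (q ^ (j + 1) + ε) ≠ 0 := mul_ne_zero (hq0 _) (hq1 j hχ)
      refine mul_right_cancel₀ hne ?_
      linear_combination 2 * hs + (q ^ (2 * (j + d + 1) + 1) - q ^ (j + d + 1)) * h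
  exact ⟨hodd, hodd_even j hodd⟩

/-- The quadratic character is `1` on one class and `-1` on the other, so its terms cancel in the
sum. When rank and codimension are both even, the cross-multiplied sum contains `(q^d + 1)(q^(j+1) +
1) + (q^d - 1)(q^(j+1) - 1) = 2(q^(j+d+1) + 1)`, and `gaussBinom_absorb` finishes. Rank 0 carries no
discriminant and is separate. -/
theorem idemCount_formulas (h2 : (2 : F) ≠ 0) (hsq : IsSquare (-1 : F)) (j d : ℕ) :
    (idemCount F (2 * j + 2 * d) (2 * j) : ℤ) = (Fintype.card F : ℤ) ^ (2 * j * d) *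
      gaussBinom ((Fintype.card F : ℤ) ^ 2) j d ∧
    (idemCount F (2 * j + (2 * d + 1)) (2 * j) : ℤ) = (Fintype.card F : ℤ) ^ (2 * j * d + 2 * j) *
      gaussBinom ((Fintype.card F : ℤ) ^ 2) j d ∧
    (idemCount F (2 * j + 1 + 2 * d) (2 * j + 1) : ℤ) =
      (Fintype.card F : ℤ) ^ (2 * j * d + 2 * d) * gaussBinom ((Fintype.card F : ℤ) ^ 2) j d ∧
    (idemCount F (2 * j + 1 + (2 * d + 1)) (2 * j + 1) : ℤ) =
      (Fintype.card F : ℤ) ^ (2 * j * d + j + d) * (((Fintype.card F : ℤ) ^ (j + d + 1) - 1) *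
        gaussBinom ((Fintype.card F : ℤ) ^ 2) j d) := by
  classical
  have hF := ringChar_ne_two h2
  obtain ⟨δ, hδ⟩ := FiniteField.exists_nonsquare hF
  have hδ0 : δ ≠ 0 := by rintro rfl; exact hδ IsSquare.zero
  have hχ := quadraticChar_neg_one_iff_not_isSquare.2 hδ
  have a1 := fun j => projCount_even_codim h2 hsq (one_ne_zero (α := F)) j d
  have a2 := fun j => projCount_even_codim h2 hsq hδ0 j d
  have b1 := fun j => projCount_odd_codim h2 hsq (one_ne_zero (α := F)) j d
  have b2 := fun j => projCount_odd_codim h2 hsq hδ0 j d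
  simp only [map_one] at a1 b1
  rw [hχ] at a2 b2
  have hs : ∀ n k, (idemCount F n (k + 1) : ℤ) = projCount n (lastWeight (k + 1) (1 : F)) +
      projCount n (lastWeight (k + 1) δ) := fun n k => by
    rw [idemCount_succ h2 hδ, Nat.cast_add]
  have hq1 := card_pow_add_ne_zero (F := F)
  refine ⟨?_, ?_, ?_, ?_⟩
  · cases j with
    | zero => simp [idemCount_zero]
    | succ j =>
      rw [mul_add, mul_one, hs]
      have h1 := (a1 j).2
      have h3 := (a2 j).2
      have hb := gaussBinom_absorb ((Fintype.card F : ℤ) ^ 2) j d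
      have hne : 2 * (((Fintype.card F : ℤ) ^ (j + 1) + 1) *
          ((Fintype.card F : ℤ) ^ (j + 1) + -1)) ≠ 0 :=
        mul_ne_zero two_ne_zero (mul_ne_zero (hq1 j (Or.inl rfl)) (hq1 j (Or.inr rfl)))
      refine mul_right_cancel₀ hne ?_
      generalize (Fintype.card F : ℤ) = q at *
      linear_combination (q ^ (j + 1) + 1) * h1 + (q ^ (j + 1) - 1) * h3 -
        2 * q ^ (2 * (j + 1) * d) * hb
  · cases j with
    | zero => simp [idemCount_zero]
    | succ j =>
      rw [mul_add, mul_one, hs]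
      have h1 := (b1 j).2
      have h3 := (b2 j).2
      refine mul_left_cancel₀ (two_ne_zero (α := ℤ)) ?_
      linear_combination h1 + h3
  · rw [hs]
    have h1 := (a1 j).1
    have h3 := (a2 j).1
    refine mul_left_cancel₀ (two_ne_zero (α := ℤ)) ?_
    linear_combination h1 + h3
  · rw [hs]
    have h1 := (b1 j).1
    have h3 := (b2 j).1
    refine mul_left_cancel₀ (two_ne_zero (α := ℤ)) ?_
    linear_combination h1 + h3

end

theorem idemCount_eq_cellPolynomial {F : Type*} [Field F] [Fintype F] (h2 : (2 : F) ≠ 0)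
    (hsq : IsSquare (-1 : F)) (k l : ℕ) :
    (cellPolynomial k (k + l)).natDegree ≤ k * l ∧
    (idemCount F (k + l) k : ℤ) =
      (Fintype.card F : ℤ) ^ (k * l - (cellPolynomial k (k + l)).natDegree) *
        (cellPolynomial k (k + l)).eval (Fintype.card F : ℤ) := by
  have heval : ∀ a b, (gaussBinom ((X : ℤ[X]) ^ 2) a b).eval (Fintype.card F : ℤ) =
      gaussBinom ((Fintype.card F : ℤ) ^ 2) a b := fun a b => by
    rw [← coe_evalRingHom, map_gaussBinom]
    simp
  obtain ⟨j, rfl | rfl⟩ := Nat.even_or_odd' k <;> obtain ⟨d, rfl | rfl⟩ := Nat.even_or_odd' l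
  · rw [cellPolynomial_even_even, (gaussBinom_monic_natDegree j d).2, heval,
      (idemCount_formulas h2 hsq j d).1]
    have e : 2 * j * (2 * d) = 2 * (j * d) + 2 * j * d := by ring
    rw [e, Nat.add_sub_cancel_left]
    exact ⟨Nat.le_add_right _ _, rfl⟩
  · rw [cellPolynomial_even_odd, (gaussBinom_monic_natDegree j d).2, heval,
      (idemCount_formulas h2 hsq j d).2.1]
    have e : 2 * j * (2 * d + 1) = 2 * (j * d) + (2 * j * d + 2 * j) := by ring
    rw [e, Nat.add_sub_cancel_left]
    exact ⟨Nat.le_add_right _ _, rfl⟩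
  · rw [cellPolynomial_odd_even, (gaussBinom_monic_natDegree j d).2, heval,
      (idemCount_formulas h2 hsq j d).2.2.1]
    have e : (2 * j + 1) * (2 * d) = 2 * (j * d) + (2 * j * d + 2 * d) := by ring
    rw [e, Nat.add_sub_cancel_left]
    exact ⟨Nat.le_add_right _ _, rfl⟩
  · rw [cellPolynomial_odd_odd, natDegree_cellPolynomial_odd_odd, eval_mul, heval,
      (idemCount_formulas h2 hsq j d).2.2.2]
    have e : (2 * j + 1) * (2 * d + 1) = j + d + 1 + 2 * (j * d) + (2 * j * d + j + d) := by ring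
    rw [e, Nat.add_sub_cancel_left]
    exact ⟨Nat.le_add_right _ _, by simp⟩

/-! ### Points of the homogeneous variety as symmetric idempotents -/

section

variable {E : Type*} [Field E] {k n : ℕ}

theorem SO_transpose_mul (g : SO n E) : g.1ᵀ * g.1 = 1 :=
  mul_eq_one_comm.1 (SO_mul_transpose g)

/-- The orthogonal projection onto the span of the first `k` basis vectors. -/
def stdProj (k n : ℕ) (E : Type*) [Field E] : Matrix (Fin n) (Fin n) E :=
  diagonal fun i => if (i : ℕ) < k then 1 else 0

theorem mem_blockSubgroup_iff {g : SO n E} :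
    g ∈ blockSubgroup k n E ↔ g.1 * stdProj k n E = stdProj k n E * g.1 := by
  change (∀ i j : Fin n, ¬((i : ℕ) < k ↔ (j : ℕ) < k) → g.1 i j = 0) ↔ _
  unfold stdProj
  constructor
  · intro h
    ext i j
    rw [Matrix.mul_diagonal, Matrix.diagonal_mul]
    by_cases hij : (i : ℕ) < k ↔ (j : ℕ) < k
    · simp [hij]
    · simp [h i j hij]
  · intro h i j hij
    have h1 := congrFun (congrFun h i) j
    rw [Matrix.mul_diagonal, Matrix.diagonal_mul] at h1
    by_cases hi : (i : ℕ) < k <;> by_cases hj : (j : ℕ) < k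
    · exact absurd (iff_of_true hi hj) hij
    · simpa [hi, hj] using h1.symm
    · simpa [hi, hj] using h1
    · exact absurd (iff_of_false hi hj) hij

/-- The projection with image `g ⟨e_1, …, e_k⟩`. -/
def conjProj (k : ℕ) (g : SO n E) : Matrix (Fin n) (Fin n) E := g.1 * stdProj k n E * g.1ᵀ

theorem conjProj_eq_iff {g g' : SO n E} :
    conjProj k g = conjProj k g' ↔ g⁻¹ * g' ∈ blockSubgroup k n E := by
  rw [mem_blockSubgroup_iff]
  change _ ↔ g.1ᵀ * g'.1 * stdProj k n E = stdProj k n E * (g.1ᵀ * g'.1)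
  unfold conjProj
  constructor
  · intro h
    calc g.1ᵀ * g'.1 * stdProj k n E
        = g.1ᵀ * (g'.1 * stdProj k n E * g'.1ᵀ) * g'.1 := by
          simp only [Matrix.mul_assoc, SO_transpose_mul, Matrix.mul_one]
      _ = g.1ᵀ * g.1 * (stdProj k n E * (g.1ᵀ * g'.1)) := by
          rw [← h]; simp only [Matrix.mul_assoc]
      _ = _ := by rw [SO_transpose_mul, Matrix.one_mul]
  · intro h
    calc g.1 * stdProj k n E * g.1ᵀ
        = g.1 * (stdProj k n E * (g.1ᵀ * g'.1)) * g'.1ᵀ := by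
          simp only [Matrix.mul_assoc, SO_mul_transpose, Matrix.mul_one]
      _ = g.1 * g.1ᵀ * (g'.1 * stdProj k n E * g'.1ᵀ) := by
          rw [← h]; simp only [Matrix.mul_assoc]
      _ = _ := by rw [SO_mul_transpose, Matrix.one_mul]

/-- A point of the variety, as an orthogonal projection. -/
def toProj (k n : ℕ) (E : Type*) [Field E] : Points k n E → Matrix (Fin n) (Fin n) E :=
  fun x => Quotient.liftOn' x (conjProj k) fun a b h => by
    rw [QuotientGroup.leftRel_apply] at h
    exact conjProj_eq_iff.2 h

theorem toProj_injective : Function.Injective (toProj k n E) := by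
  intro x y
  refine Quotient.inductionOn₂' x y fun a b h => ?_
  refine Quotient.sound' ?_
  rw [QuotientGroup.leftRel_apply]
  exact conjProj_eq_iff.1 h

theorem toProj_pointsMap (φ : E →+* E) (x : Points k n E) :
    toProj k n E (pointsMap k n φ x) = (toProj k n E x).map φ := by
  refine Quotient.inductionOn' x fun g => ?_
  change g.1.map φ * stdProj k n E * (g.1.map φ)ᵀ = (g.1 * stdProj k n E * g.1ᵀ).map φ
  have h : (stdProj k n E).map φ = stdProj k n E := by
    unfold stdProj
    rw [diagonal_map (map_zero φ)]
    congr 1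
    ext i
    simp only [apply_ite φ, map_one, map_zero]
  rw [Matrix.map_mul, Matrix.map_mul, h, transpose_map]

theorem stdProj_mul_self : stdProj k n E * stdProj k n E = stdProj k n E := by
  unfold stdProj
  rw [diagonal_mul_diagonal]
  congr 1
  ext i
  split_ifs <;> simp

theorem isSymmIdem_conjProj (g : SO n E) : IsSymmIdem (conjProj k g) where
  transpose_eq := by
    unfold conjProj stdProj
    rw [transpose_mul, transpose_mul, transpose_transpose, diagonal_transpose, Matrix.mul_assoc]
  mul_self := by
    unfold conjProj
    calc g.1 * stdProj k n E * g.1ᵀ * (g.1 * stdProj k n E * g.1ᵀ)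
        = g.1 * stdProj k n E * (g.1ᵀ * g.1) * (stdProj k n E * g.1ᵀ) := by
          simp only [Matrix.mul_assoc]
      _ = g.1 * (stdProj k n E * stdProj k n E) * g.1ᵀ := by
          rw [SO_transpose_mul, Matrix.mul_one]; simp only [Matrix.mul_assoc]
      _ = _ := by rw [stdProj_mul_self]

theorem rank_conjProj {l : ℕ} (g : SO (k + l) E) : (conjProj k g).rank = k := by
  classical
  have hu : IsUnit g.1.det := by
    rw [(mem_specialOrthogonalGroup_iff.1 g.2).2]
    exact isUnit_one
  unfold conjProj
  rw [rank_mul_eq_left_of_isUnit_det _ _ (by rwa [det_transpose]),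
    rank_mul_eq_right_of_isUnit_det _ _ hu]
  unfold stdProj
  rw [rank_diagonal, Fintype.card_subtype]
  have h1 := congrArg Finset.card (firstBlock_eq_map k l)
  rw [Finset.card_map, Finset.card_univ, Fintype.card_fin] at h1
  have h3 : (Finset.univ.filter fun i : Fin (k + l) => (if (i : ℕ) < k then (1 : E) else 0) ≠ 0) =
      firstBlock k (k + l) := by
    ext i
    simp
  rw [h3, h1]

theorem IsSymmIdem.one_sub {P : Matrix (Fin n) (Fin n) E} (hP : IsSymmIdem P) :
    IsSymmIdem (1 - P) where
  transpose_eq := by rw [transpose_sub, transpose_one, hP.transpose_eq]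
  mul_self := by
    rw [Matrix.sub_mul, Matrix.mul_sub, Matrix.mul_sub, hP.mul_self]
    simp

theorem IsSymmIdem.map {K : Type*} [Field K] (φ : E →+* K) {P : Matrix (Fin n) (Fin n) E} :
    IsSymmIdem (P.map φ) ↔ IsSymmIdem P := by
  have hinj : Function.Injective fun A : Matrix (Fin n) (Fin n) E => A.map φ :=
    Matrix.map_injective φ.injective
  constructor
  · rintro ⟨h1, h2⟩
    refine ⟨hinj ?_, hinj ?_⟩
    · dsimp only
      rw [transpose_map, h1]
    · dsimp only
      rw [Matrix.map_mul, h2]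
  · rintro ⟨h1, h2⟩
    exact ⟨by rw [← transpose_map, h1], by rw [← Matrix.map_mul, h2]⟩

/-- If the determinant is `-1`, the sign of the first coordinate is changed; this diagonal matrix
commutes with the standard projection, so the conjugate is the same. -/
theorem exists_SO_of_orthogonal {l : ℕ} {g : Matrix (Fin (k + l)) (Fin (k + l)) E}
    (hg : g * gᵀ = 1) : ∃ h : SO (k + l) E, conjProj k h = g * stdProj k (k + l) E * gᵀ := by
  have hmem : ∀ {h : Matrix (Fin (k + l)) (Fin (k + l)) E}, h * hᵀ = 1 → h.det = 1 →
      h ∈ specialOrthogonalGroup (Fin (k + l)) E := fun h1 h2 =>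
    mem_specialOrthogonalGroup_iff.2 ⟨(mem_orthogonalGroup_iff _ _).2 h1, h2⟩
  have hdet : g.det * g.det = 1 := by
    have := congrArg det hg
    rwa [det_mul, det_transpose, det_one] at this
  rcases mul_self_eq_one_iff.1 hdet with h1 | h1
  · exact ⟨⟨g, hmem hg h1⟩, rfl⟩
  rcases Nat.eq_zero_or_pos (k + l) with h0 | hpos
  · have : IsEmpty (Fin (k + l)) := by rw [h0]; infer_instance
    exact ⟨⟨g, hmem hg det_isEmpty⟩, rfl⟩
  let i₀ : Fin (k + l) := ⟨0, hpos⟩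
  let s : Matrix (Fin (k + l)) (Fin (k + l)) E := diagonal (Function.update 1 i₀ (-1))
  have hss : s * s = 1 := by
    simp only [s]
    rw [diagonal_mul_diagonal, ← diagonal_one]
    congr 1
    ext i
    by_cases hi : i = i₀
    · subst hi; simp
    · simp [hi]
  have hst : sᵀ = s := diagonal_transpose _
  have hsd : s.det = -1 := by
    simp only [s]
    rw [det_diagonal, Finset.prod_update_of_mem (Finset.mem_univ _)]
    simp
  have hsD : s * stdProj k (k + l) E = stdProj k (k + l) E * s := by
    simp only [s, stdProj]
    rw [diagonal_mul_diagonal, diagonal_mul_diagonal]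
    congr 1
    ext i
    rw [mul_comm]
  refine ⟨⟨g * s, hmem ?_ ?_⟩, ?_⟩
  · rw [transpose_mul, hst]
    calc g * s * (s * gᵀ) = g * (s * s) * gᵀ := by simp only [Matrix.mul_assoc]
      _ = 1 := by rw [hss, Matrix.mul_one, hg]
  · rw [det_mul, h1, hsd]; ring
  · change g * s * stdProj k (k + l) E * (g * s)ᵀ = _
    rw [transpose_mul, hst]
    calc g * s * stdProj k (k + l) E * (s * gᵀ) = g * (s * stdProj k (k + l) E) * s * gᵀ := by
          simp only [Matrix.mul_assoc]
      _ = g * stdProj k (k + l) E * (s * s) * gᵀ := by rw [hsD]; simp only [Matrix.mul_assoc]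
      _ = _ := by rw [hss, Matrix.mul_one]

/-- Orthonormal bases of the images of `P` and `1 - P` together form an orthogonal matrix that
carries the standard projection to `P`. -/
theorem exists_conjProj_eq [IsAlgClosed E] (h2 : (2 : E) ≠ 0) {l : ℕ}
    {P : Matrix (Fin (k + l)) (Fin (k + l)) E} (hP : IsSymmIdem P) (hr : P.rank = k) :
    ∃ h : SO (k + l) E, conjProj k h = P := by
  have hone : ∀ m : ℕ, diagonal (fun _ : Fin m => (1 : E))⁻¹ = 1 := fun m => by
    rw [← diagonal_one]
    congr 1
    ext i
    exact inv_one
  have hX := hP.exists_isOrthFrame_one h2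
  have hY := hP.one_sub.exists_isOrthFrame_one h2
  rw [hr] at hX
  generalize (1 - P).rank = m at hY
  obtain ⟨X, hX⟩ := hX
  obtain ⟨Y, hY⟩ := hY
  have hXp := hX.proj
  have hYp := hY.proj
  rw [hone, Matrix.mul_one] at hXp hYp
  have hYP : Y * P = 0 := by
    have h := hY.mul_proj fun _ => one_ne_zero
    rw [Matrix.mul_sub, Matrix.mul_one, sub_eq_self] at h
    exact h
  have hYX : Y * Xᵀ = 0 := by
    rw [← hX.mul_proj fun _ => one_ne_zero, transpose_mul, hP.transpose_eq, ← Matrix.mul_assoc,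
      hYP, Matrix.zero_mul]
  have hXY : X * Yᵀ = 0 := by
    rw [← transpose_transpose X, ← transpose_mul, hYX, transpose_zero]
  have hXg := hX.gram
  have hYg := hY.gram
  rw [diagonal_one] at hXg hYg
  have hleft : fromRows X Y * fromCols Xᵀ Yᵀ = 1 := by
    rw [fromRows_mul_fromCols, hXg, hYg, hXY, hYX, fromBlocks_one]
  have hright : fromCols Xᵀ Yᵀ * fromRows X Y = 1 := by
    rw [fromCols_mul_fromRows, hXp, hYp, add_sub_cancel]
  -- The stacked matrix is invertible, hence square, which shows that `1 - P` has rank `l`.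
  have hcard := square_of_invertible _ _ hleft hright
  rw [Fintype.card_sum, Fintype.card_fin, Fintype.card_fin, Fintype.card_fin,
    Nat.add_left_cancel_iff] at hcard
  subst hcard
  let R : Matrix (Fin (k + m)) (Fin (k + m)) E := of (Fin.append X Y)
  have hRl : ∀ i, R (Fin.castAdd m i) = X i := fun i => Fin.append_left X Y i
  have hRr : ∀ i, R (Fin.natAdd k i) = Y i := fun i => Fin.append_right X Y i
  have hRR : Rᵀ * Rᵀᵀ = 1 := by
    have h1 : Rᵀ * Rᵀᵀ = Xᵀ * X + Yᵀ * Y := by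
      ext a b
      rw [Matrix.add_apply, Matrix.mul_apply, Matrix.mul_apply, Matrix.mul_apply, Fin.sum_univ_add]
      simp only [transpose_apply, hRl, hRr]
    rw [h1, hXp, hYp, add_sub_cancel]
  obtain ⟨g, hg⟩ := exists_SO_of_orthogonal hRR
  refine ⟨g, hg.trans ?_⟩
  rw [← hXp]
  ext a b
  unfold stdProj
  rw [Matrix.mul_apply, Matrix.mul_apply, Fin.sum_univ_add]
  simp only [Matrix.mul_diagonal, transpose_apply, hRl, hRr]
  simp

theorem range_toProj [IsAlgClosed E] (h2 : (2 : E) ≠ 0) (k l : ℕ) :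
    Set.range (toProj k (k + l) E) = {P | IsSymmIdem P ∧ P.rank = k} := by
  ext P
  constructor
  · rintro ⟨x, rfl⟩
    refine Quotient.inductionOn' x fun g => ?_
    exact ⟨isSymmIdem_conjProj g, rank_conjProj g⟩
  · rintro ⟨hP, hr⟩
    obtain ⟨g, hg⟩ := exists_conjProj_eq h2 hP hr
    exact ⟨Quotient.mk'' g, hg⟩

end

/-! ### Descent from the algebraic closure to the finite field -/

section

variable {F : Type*} [Field F] [Fintype F] {k n : ℕ}

/-- The images of the `q` elements of `F` already exhaust the at most `q` roots of `X^q - X`. -/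
theorem mem_range_algebraMap_iff {K : Type*} [Field K] [Algebra F K] {x : K} :
    x ∈ Set.range (algebraMap F K) ↔ x ^ Fintype.card F = x := by
  classical
  constructor
  · rintro ⟨a, rfl⟩
    rw [← map_pow, FiniteField.pow_card]
  · intro hx
    have hne := FiniteField.X_pow_card_sub_X_ne_zero K (Fintype.one_lt_card (α := F))
    have hsub : Finset.univ.image (algebraMap F K) ⊆
        (X ^ Fintype.card F - X : K[X]).roots.toFinset := by
      intro y hy
      obtain ⟨a, -, rfl⟩ := Finset.mem_image.1 hy
      rw [Multiset.mem_toFinset, mem_roots hne]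
      simp [← map_pow, FiniteField.pow_card]
    have heq := Finset.eq_of_subset_of_card_le hsub (by
      rw [Finset.card_image_of_injective _ (algebraMap F K).injective, Finset.card_univ]
      refine (Multiset.toFinset_card_le _).trans ((card_roots' _).trans ?_)
      rw [FiniteField.X_pow_card_sub_X_natDegree_eq K (Fintype.one_lt_card (α := F))])
    have hmem : x ∈ (X ^ Fintype.card F - X : K[X]).roots.toFinset := by
      rw [Multiset.mem_toFinset, mem_roots hne]
      simp [hx]
    rw [← heq] at hmem
    obtain ⟨a, -, ha⟩ := Finset.mem_image.1 hmem
    exact ⟨a, ha⟩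

/-- An orthogonal frame stays one under a field homomorphism, and its length is the rank on both
sides. -/
theorem IsSymmIdem.rank_map (h2 : (2 : F) ≠ 0) {K : Type*} [Field K] (φ : F →+* K)
    {P : Matrix (Fin n) (Fin n) F} (hP : IsSymmIdem P) : (P.map φ).rank = P.rank := by
  have hF := ringChar_ne_two h2
  obtain ⟨δ, hδ⟩ := FiniteField.exists_nonsquare hF
  have hδ0 : δ ≠ 0 := by rintro rfl; exact hδ IsSquare.zero
  by_cases h0 : P.rank = 0
  · have hP0 : P = 0 := by
      by_contra hne
      obtain ⟨v, hv, hq⟩ := hP.exists_anisotropic h2 hne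
      have := hP.rank_sub_lt hv hq
      omega
    subst hP0
    simp
  · obtain ⟨r, hr⟩ := Nat.exists_eq_succ_of_ne_zero h0
    obtain ⟨c, hc, X, hX⟩ := hP.exists_isOrthFrame_lastWeight h2 hδ hr
    have hc0 : ∀ i, lastWeight (r + 1) c i ≠ 0 := by
      refine lastWeight_ne_zero ?_
      rcases hc with rfl | rfl
      · exact one_ne_zero
      · exact hδ0
    have h : IsOrthFrame (fun i => φ (lastWeight (r + 1) c i)) (X.map φ) (P.map φ) := by
      constructor
      · rw [← transpose_map, ← Matrix.map_mul, hX.gram, diagonal_map (map_zero φ)]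
      · rw [← hX.proj, Matrix.map_mul, Matrix.map_mul, transpose_map, diagonal_map (map_zero φ)]
        congr 3
        ext i
        simp
    rw [h.rank_eq fun i => by simpa using hc0 i, hr]

theorem toProj_image_rationalPoints (h2 : (2 : F) ≠ 0) (k l : ℕ) :
    toProj k (k + l) (AlgebraicClosure F) '' rationalPoints k (k + l) F =
      (fun P => P.map (algebraMap F (AlgebraicClosure F))) ''
        {P : Matrix (Fin (k + l)) (Fin (k + l)) F | IsSymmIdem P ∧ P.rank = k} := by
  have h2' : (2 : AlgebraicClosure F) ≠ 0 := fun h =>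
    h2 ((algebraMap F (AlgebraicClosure F)).injective (by rw [map_ofNat, map_zero, h]))
  have hfix : ∀ x, x ∈ rationalPoints k (k + l) F ↔
      ∀ i j, toProj k (k + l) (AlgebraicClosure F) x i j ^ Fintype.card F =
        toProj k (k + l) (AlgebraicClosure F) x i j := by
    intro x
    unfold rationalPoints
    rw [Set.mem_ofPred_eq, ← toProj_injective.eq_iff, toProj_pointsMap]
    constructor
    · intro h i j
      exact congrFun (congrFun h i) j
    · intro h
      ext i j
      exact h i j
  have hrange := range_toProj h2' k l
  ext P
  constructor
  · rintro ⟨x, hx, rfl⟩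
    rw [hfix] at hx
    have hx' : ∀ i j, ∃ a, algebraMap F (AlgebraicClosure F) a =
        toProj k (k + l) (AlgebraicClosure F) x i j := fun i j =>
      mem_range_algebraMap_iff.2 (hx i j)
    choose Q hQ using hx'
    have hQ' : (of Q).map (algebraMap F (AlgebraicClosure F)) =
        toProj k (k + l) (AlgebraicClosure F) x := by
      ext i j
      exact hQ i j
    have hmem : toProj k (k + l) (AlgebraicClosure F) x ∈
        {P | IsSymmIdem P ∧ P.rank = k} := hrange ▸ Set.mem_range_self x
    rw [← hQ'] at hmem
    have hs := (IsSymmIdem.map _).1 hmem.1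
    exact ⟨of Q, ⟨hs, (hs.rank_map h2 _).symm.trans hmem.2⟩, hQ'⟩
  · rintro ⟨Q, ⟨hQ, hr⟩, rfl⟩
    have hmem : Q.map (algebraMap F (AlgebraicClosure F)) ∈
        Set.range (toProj k (k + l) (AlgebraicClosure F)) := by
      rw [hrange]
      exact ⟨(IsSymmIdem.map _).2 hQ, by rw [hQ.rank_map h2, hr]⟩
    obtain ⟨x, hx⟩ := hmem
    refine ⟨x, (hfix x).2 fun i j => ?_, hx⟩
    rw [hx]
    exact mem_range_algebraMap_iff.1 ⟨Q i j, rfl⟩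

theorem finite_rationalPoints_and_ncard (h2 : (2 : F) ≠ 0) (k l : ℕ) :
    (rationalPoints k (k + l) F).Finite ∧
      (rationalPoints k (k + l) F).ncard = idemCount F (k + l) k := by
  have himage := toProj_image_rationalPoints h2 k l
  constructor
  · refine Set.Finite.of_finite_image (f := toProj k (k + l) (AlgebraicClosure F)) ?_
      toProj_injective.injOn
    rw [himage]
    exact (Set.toFinite _).image _
  · rw [← Set.ncard_image_of_injective _ (toProj_injective (E := AlgebraicClosure F)), himage,
      Set.ncard_image_of_injective _
        (Matrix.map_injective (algebraMap F (AlgebraicClosure F)).injective)]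
    rfl

end

end RealGrassmannian

end

theorem theorem4p4 {F : Type*} [Field F] [Fintype F] (hchar : (2 : F) ≠ 0)
    (hsqrt : IsSquare (-1 : F)) (k n : ℕ) (hkn : k ≤ n) :
    (RealGrassmannian.rationalPoints k n F).Finite ∧
    (RealGrassmannian.cellPolynomial k n).natDegree ≤ k * (n - k) ∧
    ((RealGrassmannian.rationalPoints k n F).ncard : ℤ) =
      (Fintype.card F : ℤ) ^ (k * (n - k) - (RealGrassmannian.cellPolynomial k n).natDegree) *
        (RealGrassmannian.cellPolynomial k n).eval (Fintype.card F : ℤ) := by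
  obtain ⟨l, rfl⟩ := Nat.exists_eq_add_of_le hkn
  obtain ⟨h1, h2⟩ := RealGrassmannian.finite_rationalPoints_and_ncard hchar k l
  obtain ⟨h3, h4⟩ := RealGrassmannian.idemCount_eq_cellPolynomial hchar hsqrt k l
  rw [Nat.add_sub_cancel_left, h2]
  exact ⟨h1, h3, h4⟩
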